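/- Let $R$ be an associative ring with $1$. Modules are right $R$-modules, and $\mathrm{fpmod}(R)$ is the category of finitely presented right $R$-modules. Let $\mathcal{E}$ be a nonempty full subcategory of $\mathrm{fpmod}(R)$ that is closed under extensions (if $0\to X_1\to X_2\to X_3\to 0$ is a short exact sequence of $R$-modules and $X_1,X_3\in\mathcal{E}$, then $X_2\in\mathcal{E}$) and all of whose objects have projective dimension at most $1$. Let $R\to R_{\mathcal{E}}$ be the universal localisation of $R$ at $\mathcal{E}$, that is, the universal ring homomorphism $R\to S$ such that $\alpha\otimes_R S$ is an isomorphism for every injective homomorphism $\alpha\colon P\to Q$ between finitely generated projective right $R$-modules whose cokernel is isomorphic to an object of $\mathcal{E}$. Let $M$ be a finitely presented right $R$-module. (1) An element $m\in M$ lies in the kernel of the natural homomorphism $M\to M\otimes_R R_{\mathcal{E}}$, $m\mapsto m\otimes 1$, if and only if there exist a short exact sequence of right $R$-modules $0\to M\xrightarrow{\,i\,} N\to E\to 0$ and a homomorphism $\varphi\colon E'\to N$ with $E,E'\in\mathcal{E}$ such that $i(m)$ lies in the image of $\varphi$. (2) $M\otimes_R R_{\mathcal{E}}=0$ if and only if there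 exist a short exact sequence of right $R$-modules $0\to M\xrightarrow{\,i\,} N\to E\to 0$ and a homomorphism $\varphi\colon E'\to N$ with $E,E'\in\mathcal{E}$ such that $i(M)$ is contained in the image of $\varphi$. -/

import Mathlib

open scoped TensorProduct

universe u

/-- The abelian group `M ⊗_R S` for a right `R`-module `M` and a ring homomorphism `φ : R → S`:
the tensor product over `ℤ` modulo the relations `m r ⊗ s = m ⊗ φ(r) s`. Right `R`-modules are
modules over the opposite ring `Rᵐᵒᵖ`. -/
def Induced {R S : Type*} [Ring R] [Ring S] (φ : R →+* S)
    (M : Type*) [AddCommGroup M] [Module Rᵐᵒᵖ M] : Type _ :=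
  (M ⊗[ℤ] S) ⧸ Submodule.span ℤ
    {t : M ⊗[ℤ] S | ∃ (m : M) (r : R) (s : S),
      t = (MulOpposite.op r • m) ⊗ₜ[ℤ] s - m ⊗ₜ[ℤ] (φ r * s)}

namespace Induced

instance instAddCommGroup {R S : Type*} [Ring R] [Ring S] (φ : R →+* S)
    (M : Type*) [AddCommGroup M] [Module Rᵐᵒᵖ M] : AddCommGroup (Induced φ M) :=
  inferInstanceAs (AddCommGroup ((M ⊗[ℤ] S) ⧸ Submodule.span ℤ
    {t : M ⊗[ℤ] S | ∃ (m : M) (r : R) (s : S),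
      t = (MulOpposite.op r • m) ⊗ₜ[ℤ] s - m ⊗ₜ[ℤ] (φ r * s)}))

/-- The element `m ⊗ s`. -/
def tmul {R S : Type*} [Ring R] [Ring S] (φ : R →+* S)
    {M : Type*} [AddCommGroup M] [Module Rᵐᵒᵖ M] (m : M) (s : S) : Induced φ M :=
  Submodule.Quotient.mk (m ⊗ₜ[ℤ] s)

section Basic

variable {R S : Type*} [Ring R] [Ring S] (φ : R →+* S)
  {M N : Type*} [AddCommGroup M] [Module Rᵐᵒᵖ M] [AddCommGroup N] [Module Rᵐᵒᵖ N]

theorem add_tmul (m m' : M) (s : S) : tmul φ (m + m') s = tmul φ m s + tmul φ m' s := by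
  unfold tmul
  rw [TensorProduct.add_tmul]; rfl

theorem tmul_add (m : M) (s s' : S) : tmul φ m (s + s') = tmul φ m s + tmul φ m s' := by
  unfold tmul
  rw [TensorProduct.tmul_add]; rfl

theorem smul_tmul (m : M) (r : R) (s : S) :
    tmul φ (MulOpposite.op r • m) s = tmul φ m (φ r * s) :=
  (Submodule.Quotient.eq _).2 (Submodule.subset_span ⟨m, r, s, rfl⟩)

theorem induction_on {p : Induced φ M → Prop} (x : Induced φ M)
    (h0 : p 0) (ht : ∀ m s, p (tmul φ m s)) (ha : ∀ x y, p x → p y → p (x + y)) : p x := by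
  obtain ⟨t, rfl⟩ := Submodule.Quotient.mk_surjective _ x
  induction t using TensorProduct.induction_on with
  | zero => exact h0
  | tmul m s => exact ht m s
  | add x y hx hy => exact ha _ _ hx hy

/-- The universal property of `M ⊗_R S`: balanced biadditive maps factor through it. -/
def lift {A : Type*} [AddCommGroup A] (f : M →+ S →+ A)
    (hf : ∀ m (r : R) s, f (MulOpposite.op r • m) s = f m (φ r * s)) : Induced φ M →+ A :=
  (Submodule.liftQ (Submodule.span ℤ
    {t : M ⊗[ℤ] S | ∃ (m : M) (r : R) (s : S),
      t = (MulOpposite.op r • m) ⊗ₜ[ℤ] s - m ⊗ₜ[ℤ] (φ r * s)})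
    ((TensorProduct.liftAddHom f (fun n m s => by
      rw [map_zsmul, map_zsmul, AddMonoidHom.zsmul_apply])).toIntLinearMap)
    (Submodule.span_le.2 (by
      rintro _ ⟨m, r, s, rfl⟩
      simp [hf]))).toAddMonoidHom

@[simp] theorem lift_tmul {A : Type*} [AddCommGroup A] (f : M →+ S →+ A)
    (hf : ∀ m (r : R) s, f (MulOpposite.op r • m) s = f m (φ r * s)) (m : M) (s : S) :
    lift φ f hf (tmul φ m s) = f m s := by
  rfl

/-- The natural map `M → M ⊗_R S`, `m ↦ m ⊗ 1`. -/
def of (M : Type*) [AddCommGroup M] [Module Rᵐᵒᵖ M] : M →+ Induced φ M :=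
  AddMonoidHom.mk' (fun m => tmul φ m 1) (fun m m' => add_tmul φ m m' 1)

/-- The induced map `f ⊗_R S : M ⊗_R S → N ⊗_R S`. -/
def map (f : M →ₗ[Rᵐᵒᵖ] N) : Induced φ M →+ Induced φ N :=
  lift φ
    (AddMonoidHom.mk' (fun m => AddMonoidHom.mk' (fun s => tmul φ (f m) s)
      (fun s s' => tmul_add φ (f m) s s'))
      (fun m m' => by ext s; simp [add_tmul]))
    (fun m r s => by simp [smul_tmul])

@[simp] theorem map_tmul (f : M →ₗ[Rᵐᵒᵖ] N) (m : M) (s : S) :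
    map φ f (tmul φ m s) = tmul φ (f m) s := by
  simp [map]

theorem map_comp {L : Type*} [AddCommGroup L] [Module Rᵐᵒᵖ L] (g : N →ₗ[Rᵐᵒᵖ] L)
    (f : M →ₗ[Rᵐᵒᵖ] N) (x : Induced φ M) : map φ (g ∘ₗ f) x = map φ g (map φ f x) := by
  induction x using Induced.induction_on with
  | h0 => simp
  | ha x y hx hy => simp [hx, hy]
  | ht m s => simp

theorem map_equiv_bijective (e : M ≃ₗ[Rᵐᵒᵖ] N) :
    Function.Bijective (map φ (e : M →ₗ[Rᵐᵒᵖ] N)) := by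
  refine Function.bijective_iff_has_inverse.2
    ⟨map φ (e.symm : N →ₗ[Rᵐᵒᵖ] M), fun x => ?_, fun x => ?_⟩ <;>
  · induction x using Induced.induction_on with
    | h0 => simp
    | ha x y hx hy => simp [hx, hy]
    | ht m s => simp

end Basic

end Induced

section UniversalLocalisation

/-- The relations defining the universal localisation of `R` at a family of maps
`α i : P i → Q i` between finitely generated projective right `R`-modules. The generators are the
elements of `R` and, for `ξ : P i → R` and `q ∈ Q i`, a symbol `(i, ξ, q)` which stands for
`ξ (α i)⁻¹ (q)`. The relations say that `R` maps homomorphically, that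
`X_ξ : Q i → R_Σ`, `q ↦ (i, ξ, q)` is `R`-linear with `X_ξ ∘ α i = ξ` (so the symbols give a left
inverse of `α i`), and, for a dual basis `p_k, π_k` of `P i`, that `q = ∑ α i (p_k) (i, π_k, q)`
after applying any `η : Q i → R` (so the left inverse is also a right inverse). -/
inductive UniversalLocalisationRel {R : Type*} [Ring R] {ι : Type*} {P Q : ι → Type*}
    [∀ i, AddCommGroup (P i)] [∀ i, Module Rᵐᵒᵖ (P i)]
    [∀ i, AddCommGroup (Q i)] [∀ i, Module Rᵐᵒᵖ (Q i)]
    (α : ∀ i, P i →ₗ[Rᵐᵒᵖ] Q i) :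
    FreeRing (R ⊕ (Σ i, (P i →ₗ[Rᵐᵒᵖ] R) × Q i)) →
    FreeRing (R ⊕ (Σ i, (P i →ₗ[Rᵐᵒᵖ] R) × Q i)) → Prop
  | one : UniversalLocalisationRel α (FreeRing.of (Sum.inl 1)) 1
  | add (r s : R) : UniversalLocalisationRel α (FreeRing.of (Sum.inl (r + s)))
      (FreeRing.of (Sum.inl r) + FreeRing.of (Sum.inl s))
  | mul (r s : R) : UniversalLocalisationRel α (FreeRing.of (Sum.inl (r * s)))
      (FreeRing.of (Sum.inl r) * FreeRing.of (Sum.inl s))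
  | symbol_add (i : ι) (ξ : P i →ₗ[Rᵐᵒᵖ] R) (q q' : Q i) :
      UniversalLocalisationRel α (FreeRing.of (Sum.inr ⟨i, ξ, q + q'⟩))
        (FreeRing.of (Sum.inr ⟨i, ξ, q⟩) + FreeRing.of (Sum.inr ⟨i, ξ, q'⟩))
  | symbol_smul (i : ι) (ξ : P i →ₗ[Rᵐᵒᵖ] R) (q : Q i) (r : R) :
      UniversalLocalisationRel α (FreeRing.of (Sum.inr ⟨i, ξ, MulOpposite.op r • q⟩))
        (FreeRing.of (Sum.inr ⟨i, ξ, q⟩) * FreeRing.of (Sum.inl r))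
  | left_inv (i : ι) (ξ : P i →ₗ[Rᵐᵒᵖ] R) (p : P i) :
      UniversalLocalisationRel α (FreeRing.of (Sum.inr ⟨i, ξ, α i p⟩))
        (FreeRing.of (Sum.inl (ξ p)))
  | right_inv (i : ι) (n : ℕ) (p : Fin n → P i) (π : Fin n → (P i →ₗ[Rᵐᵒᵖ] R))
      (_ : ∀ x : P i, x = ∑ k, MulOpposite.op (π k x) • p k)
      (η : Q i →ₗ[Rᵐᵒᵖ] R) (q : Q i) :
      UniversalLocalisationRel α
        (∑ k, FreeRing.of (Sum.inl (η (α i (p k)))) * FreeRing.of (Sum.inr ⟨i, π k, q⟩))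
        (FreeRing.of (Sum.inl (η q)))

/-- The universal localisation `R_Σ` of `R` at a family `Σ` of maps `α i : P i → Q i` between
finitely generated projective right `R`-modules: the universal ring under `R` over which all the
`α i` become invertible (see `UniversalLocalisation.map_bijective` and
`UniversalLocalisation.existsUnique_lift`). -/
def UniversalLocalisation {R : Type*} [Ring R] {ι : Type*} {P Q : ι → Type*}
    [∀ i, AddCommGroup (P i)] [∀ i, Module Rᵐᵒᵖ (P i)]
    [∀ i, AddCommGroup (Q i)] [∀ i, Module Rᵐᵒᵖ (Q i)]
    (α : ∀ i, P i →ₗ[Rᵐᵒᵖ] Q i) : Type _ :=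
  RingQuot (UniversalLocalisationRel α)

namespace UniversalLocalisation

variable {R : Type*} [Ring R] {ι : Type*} {P Q : ι → Type*}
    [∀ i, AddCommGroup (P i)] [∀ i, Module Rᵐᵒᵖ (P i)]
    [∀ i, AddCommGroup (Q i)] [∀ i, Module Rᵐᵒᵖ (Q i)]
    (α : ∀ i, P i →ₗ[Rᵐᵒᵖ] Q i)

instance instRing : Ring (UniversalLocalisation α) :=
  inferInstanceAs (Ring (RingQuot (UniversalLocalisationRel α)))

/-- The canonical projection from the free ring on the generators. -/
def proj : FreeRing (R ⊕ (Σ i, (P i →ₗ[Rᵐᵒᵖ] R) × Q i)) →+* UniversalLocalisation α :=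
  RingQuot.mkRingHom (UniversalLocalisationRel α)

theorem proj_rel {x y : FreeRing (R ⊕ (Σ i, (P i →ₗ[Rᵐᵒᵖ] R) × Q i))}
    (h : UniversalLocalisationRel α x y) : proj α x = proj α y :=
  RingQuot.mkRingHom_rel h

/-- The canonical ring homomorphism `R → R_Σ`. -/
def of : R →+* UniversalLocalisation α where
  toFun r := proj α (FreeRing.of (Sum.inl r))
  map_one' := by rw [proj_rel α .one, map_one]
  map_mul' r s := by rw [proj_rel α (.mul r s), map_mul]
  map_add' r s := by rw [proj_rel α (.add r s), map_add]
  map_zero' := by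
    have h := proj_rel α (.add 0 0)
    rw [map_add, add_zero] at h
    exact left_eq_add.1 h

/-- The element of `R_Σ` which stands for `ξ (α i)⁻¹ (q)`. -/
def symbol {i : ι} (ξ : P i →ₗ[Rᵐᵒᵖ] R) (q : Q i) : UniversalLocalisation α :=
  proj α (FreeRing.of (Sum.inr ⟨i, ξ, q⟩))

theorem symbol_add {i : ι} (ξ : P i →ₗ[Rᵐᵒᵖ] R) (q q' : Q i) :
    symbol α ξ (q + q') = symbol α ξ q + symbol α ξ q' := by
  unfold symbol
  rw [proj_rel α (.symbol_add i ξ q q'), map_add]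

theorem symbol_smul {i : ι} (ξ : P i →ₗ[Rᵐᵒᵖ] R) (q : Q i) (r : R) :
    symbol α ξ (MulOpposite.op r • q) = symbol α ξ q * of α r := by
  unfold symbol
  rw [proj_rel α (.symbol_smul i ξ q r), map_mul]; rfl

theorem symbol_map {i : ι} (ξ : P i →ₗ[Rᵐᵒᵖ] R) (p : P i) :
    symbol α ξ (α i p) = of α (ξ p) :=
  proj_rel α (.left_inv i ξ p)

theorem sum_symbol {i : ι} {n : ℕ} (p : Fin n → P i) (π : Fin n → (P i →ₗ[Rᵐᵒᵖ] R))
    (h : ∀ x : P i, x = ∑ k, MulOpposite.op (π k x) • p k)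
    (η : Q i →ₗ[Rᵐᵒᵖ] R) (q : Q i) :
    ∑ k, of α (η (α i (p k))) * symbol α (π k) q = of α (η q) := by
  have := proj_rel α (.right_inv i n p π h η q)
  rw [map_sum] at this
  simp only [map_mul] at this
  exact this

end UniversalLocalisation

/-- A finitely generated projective right module has a finite dual basis. -/
theorem exists_dual_basis {R : Type*} [Ring R] (P : Type*) [AddCommGroup P] [Module Rᵐᵒᵖ P]
    [Module.Finite Rᵐᵒᵖ P] [Module.Projective Rᵐᵒᵖ P] :
    ∃ (n : ℕ) (p : Fin n → P) (π : Fin n → (P →ₗ[Rᵐᵒᵖ] R)),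
      ∀ x : P, x = ∑ k, MulOpposite.op (π k x) • p k := by
  obtain ⟨n, f, hf⟩ := Module.Finite.exists_fin' Rᵐᵒᵖ P
  obtain ⟨g, hg⟩ := Module.projective_lifting_property f LinearMap.id hf
  let u : Rᵐᵒᵖ →ₗ[Rᵐᵒᵖ] R :=
    { toFun := MulOpposite.unop
      map_add' := fun _ _ => rfl
      map_smul' := fun _ _ => rfl }
  refine ⟨n, fun k => f (Pi.single k 1), fun k => u ∘ₗ LinearMap.proj k ∘ₗ g, fun x => ?_⟩
  have h1 : f (g x) = x := LinearMap.congr_fun hg x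
  conv_lhs => rw [← h1, LinearMap.pi_apply_eq_sum_univ f (g x)]
  refine Finset.sum_congr rfl fun k _ => ?_
  have h2 : (Pi.single k 1 : Fin n → Rᵐᵒᵖ) = fun j => if k = j then 1 else 0 := by
    ext j; simp [Pi.single_apply, eq_comm]
  rw [← h2]
  rfl

namespace UniversalLocalisation

universe w

variable {R : Type*} [Ring R] {ι : Type*} {P Q : ι → Type*}
    [∀ i, AddCommGroup (P i)] [∀ i, Module Rᵐᵒᵖ (P i)]
    [∀ i, AddCommGroup (Q i)] [∀ i, Module Rᵐᵒᵖ (Q i)]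
    (α : ∀ i, P i →ₗ[Rᵐᵒᵖ] Q i)

theorem tmul_finsetSum {S : Type*} [Ring S] (φ : R →+* S) {M : Type*} [AddCommGroup M]
    [Module Rᵐᵒᵖ M] {κ : Type*} (t : Finset κ) (m : M) (s : κ → S) :
    Induced.tmul φ m (∑ k ∈ t, s k) = ∑ k ∈ t, Induced.tmul φ m (s k) :=
  map_sum (AddMonoidHom.mk' (fun s => Induced.tmul φ m s)
      (fun s s' => Induced.tmul_add φ m s s')) s t

theorem finsetSum_tmul {S : Type*} [Ring S] (φ : R →+* S) {M : Type*} [AddCommGroup M]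
    [Module Rᵐᵒᵖ M] {κ : Type*} (t : Finset κ) (m : κ → M) (s : S) :
    Induced.tmul φ (∑ k ∈ t, m k) s = ∑ k ∈ t, Induced.tmul φ (m k) s :=
  map_sum (AddMonoidHom.mk' (fun m => Induced.tmul φ m s)
      (fun m m' => Induced.add_tmul φ m m' s)) m t

/-- Every map of the family becomes invertible over the universal localisation. -/
theorem map_bijective (i : ι) [Module.Finite Rᵐᵒᵖ (P i)] [Module.Projective Rᵐᵒᵖ (P i)]
    [Module.Finite Rᵐᵒᵖ (Q i)] [Module.Projective Rᵐᵒᵖ (Q i)] :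
    Function.Bijective (Induced.map (of α) (α i)) := by
  obtain ⟨n, p, π, hp⟩ := exists_dual_basis (R := R) (P i)
  obtain ⟨l, y, η, hy⟩ := exists_dual_basis (R := R) (Q i)
  let β : Induced (of α) (Q i) →+ Induced (of α) (P i) :=
    Induced.lift (of α)
      (AddMonoidHom.mk' (fun q => AddMonoidHom.mk'
        (fun s => ∑ k, Induced.tmul (of α) (p k) (symbol α (π k) q * s))
        (fun s s' => by simp [mul_add, Induced.tmul_add, Finset.sum_add_distrib]))
        (fun q q' => by
          ext s
          simp [symbol_add, add_mul, Induced.tmul_add, Finset.sum_add_distrib]))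
      (fun q r s => by simp [symbol_smul, mul_assoc])
  have hβ : ∀ q s, β (Induced.tmul (of α) q s) =
      ∑ k, Induced.tmul (of α) (p k) (symbol α (π k) q * s) := fun q s => by simp [β]
  refine Function.bijective_iff_has_inverse.2 ⟨β, fun x => ?_, fun x => ?_⟩
  · induction x using Induced.induction_on with
    | h0 => simp
    | ha x y hx hy => simp [hx, hy]
    | ht m s =>
      rw [Induced.map_tmul, hβ]
      conv_rhs => rw [hp m, finsetSum_tmul]
      refine Finset.sum_congr rfl fun k _ => ?_
      rw [symbol_map, Induced.smul_tmul]
  · induction x using Induced.induction_on with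
    | h0 => simp
    | ha x y hx hy => simp [hx, hy]
    | ht q s =>
      rw [hβ, map_sum]
      conv_rhs => rw [hy q, finsetSum_tmul]
      simp only [Induced.smul_tmul, Induced.map_tmul]
      have h1 : ∀ k, Induced.tmul (of α) (α i (p k)) (symbol α (π k) q * s) =
          ∑ j, Induced.tmul (of α) (y j) (of α (η j (α i (p k))) * (symbol α (π k) q * s)) := by
        intro k
        conv_lhs => rw [hy (α i (p k)), finsetSum_tmul]
        simp only [Induced.smul_tmul]
      simp only [h1]
      rw [Finset.sum_comm]
      refine Finset.sum_congr rfl fun j _ => ?_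
      rw [← tmul_finsetSum, ← sum_symbol α p π hp (η j) q, Finset.sum_mul]
      simp only [mul_assoc]

/-- The map `M ⊗_R S → S`, `m ⊗ s ↦ ψ(ξ m) s`. -/
def eval {S : Type*} [Ring S] (ψ : R →+* S) {M : Type*} [AddCommGroup M]
    [Module Rᵐᵒᵖ M] (ξ : M →ₗ[Rᵐᵒᵖ] R) : Induced ψ M →+ S :=
  Induced.lift ψ
    (AddMonoidHom.mk' (fun m => AddMonoidHom.mk' (fun s => ψ (ξ m) * s)
      (fun s s' => mul_add _ s s')) (fun m m' => by ext s; simp [add_mul]))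
    (fun m r s => by simp [mul_assoc])

@[simp] theorem eval_tmul {S : Type*} [Ring S] (ψ : R →+* S) {M : Type*} [AddCommGroup M]
    [Module Rᵐᵒᵖ M] (ξ : M →ₗ[Rᵐᵒᵖ] R) (m : M) (s : S) :
    eval ψ ξ (Induced.tmul ψ m s) = ψ (ξ m) * s := by
  simp [eval]

/-- Right multiplication by `t` on `M ⊗_R S`. -/
def rmul {S : Type*} [Ring S] (ψ : R →+* S) (M : Type*) [AddCommGroup M]
    [Module Rᵐᵒᵖ M] (t : S) : Induced ψ M →+ Induced ψ M :=
  Induced.lift ψ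
    (AddMonoidHom.mk' (fun m => AddMonoidHom.mk' (fun s => Induced.tmul ψ m (s * t))
      (fun s s' => by simp [add_mul, Induced.tmul_add]))
      (fun m m' => by ext s; simp [Induced.add_tmul]))
    (fun m r s => by simp [mul_assoc, Induced.smul_tmul])

@[simp] theorem rmul_tmul {S : Type*} [Ring S] (ψ : R →+* S) {M : Type*} [AddCommGroup M]
    [Module Rᵐᵒᵖ M] (m : M) (s t : S) :
    rmul ψ M t (Induced.tmul ψ m s) = Induced.tmul ψ m (s * t) := by
  simp [rmul]

/-- The universal property: a ring homomorphism over which all the `α i` become invertible factors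
uniquely through the universal localisation. -/
theorem existsUnique_lift {T : Type w} [Ring T] (ψ : R →+* T)
    (hψ : ∀ i, Function.Bijective (Induced.map ψ (α i))) :
    ∃! θ : UniversalLocalisation α →+* T, θ.comp (of α) = ψ := by
  have hext : ∀ i (x : Induced ψ (P i)) (t : T),
      Induced.map ψ (α i) (rmul ψ _ t x) = rmul ψ _ t (Induced.map ψ (α i) x) := by
    intro i x t
    induction x using Induced.induction_on with
    | h0 => simp
    | ha x y hx hy => simp [hx, hy]
    | ht m s => simp
  have heval : ∀ i (ξ : P i →ₗ[Rᵐᵒᵖ] R) (x : Induced ψ (P i)) (t : T),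
      eval ψ ξ (rmul ψ _ t x) = eval ψ ξ x * t := by
    intro i ξ x t
    induction x using Induced.induction_on with
    | h0 => simp
    | ha x y hx hy => simp [hx, hy, add_mul]
    | ht m s => simp [mul_assoc]
  have hevmap : ∀ i (η : Q i →ₗ[Rᵐᵒᵖ] R) (x : Induced ψ (P i)),
      eval ψ (η ∘ₗ α i) x = eval ψ η (Induced.map ψ (α i) x) := by
    intro i η x
    induction x using Induced.induction_on with
    | h0 => simp
    | ha x y hx hy => simp [hx, hy]
    | ht m s => simp
  let e : ∀ i, Induced ψ (P i) ≃+ Induced ψ (Q i) := fun i =>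
    AddEquiv.ofBijective (Induced.map ψ (α i)) (hψ i)
  have he : ∀ i x, e i x = Induced.map ψ (α i) x := fun i x => rfl
  let G : R ⊕ (Σ i, (P i →ₗ[Rᵐᵒᵖ] R) × Q i) → T :=
    Sum.elim ψ (fun z => eval ψ z.2.1 ((e z.1).symm (Induced.tmul ψ z.2.2 1)))
  have hG : ∀ ⦃x y⦄, UniversalLocalisationRel α x y →
      FreeRing.lift G x = FreeRing.lift G y := by
    intro x y h
    induction h with
    | one => simp [G]
    | add r s => simp [G]
    | mul r s => simp [G]
    | symbol_add i ξ q q' => simp [G, Induced.add_tmul]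
    | symbol_smul i ξ q r =>
      simp only [G, FreeRing.lift_of, map_mul, Sum.elim_inr, Sum.elim_inl]
      rw [← heval]
      congr 1
      rw [AddEquiv.symm_apply_eq, he, hext, ← he, AddEquiv.apply_symm_apply]
      simp [Induced.smul_tmul]
    | left_inv i ξ p =>
      simp only [G, FreeRing.lift_of, Sum.elim_inr, Sum.elim_inl]
      have : Induced.tmul ψ (α i p) 1 = e i (Induced.tmul ψ p 1) := by simp [he]
      rw [this, AddEquiv.symm_apply_apply]
      simp
    | right_inv i n p π hp η q =>
      simp only [G, map_sum, map_mul, FreeRing.lift_of, Sum.elim_inr, Sum.elim_inl]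
      have key : ∀ x : Induced ψ (P i),
          ∑ k, ψ (η (α i (p k))) * eval ψ (π k) x = eval ψ (η ∘ₗ α i) x := by
        intro x
        induction x using Induced.induction_on with
        | h0 => simp
        | ha x y hx hy => simp [← hx, ← hy, mul_add, Finset.sum_add_distrib]
        | ht m s =>
          simp only [eval_tmul]
          conv_rhs => rw [hp m]
          simp [Finset.sum_mul, mul_assoc]
      refine (key ((e i).symm (Induced.tmul ψ q 1))).trans ?_
      rw [hevmap, ← he, AddEquiv.apply_symm_apply]
      simp
  refine ⟨RingQuot.lift ⟨FreeRing.lift G, hG⟩, ?_, ?_⟩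
  · ext r
    change RingQuot.lift ⟨FreeRing.lift G, hG⟩ (RingQuot.mkRingHom _ _) = _
    rw [RingQuot.lift_mkRingHom_apply]
    simp [G]
  · intro θ hθ
    have hθ' : ∀ r, θ (of α r) = ψ r := fun r => RingHom.congr_fun hθ r
    refine RingQuot.ringQuot_ext _ _ (FreeRing.hom_ext fun z => ?_)
    change θ (proj α (FreeRing.of z)) =
      RingQuot.lift ⟨FreeRing.lift G, hG⟩ (RingQuot.mkRingHom _ (FreeRing.of z))
    rw [RingQuot.lift_mkRingHom_apply]
    rcases z with r | ⟨i, ξ, q⟩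
    · simp only [G, FreeRing.lift_of, Sum.elim_inl]
      exact hθ' r
    · simp only [G, FreeRing.lift_of, Sum.elim_inr]
      change θ (symbol α ξ q) = _
      let X : Induced ψ (Q i) →+ T := Induced.lift ψ
        (AddMonoidHom.mk' (fun q => AddMonoidHom.mk' (fun s => θ (symbol α ξ q) * s)
          (fun s s' => mul_add _ s s')) (fun m m' => by ext s; simp [add_mul, symbol_add]))
        (fun m r s => by simp [mul_assoc, symbol_smul, hθ'])
      have hX : ∀ x : Induced ψ (P i), X (e i x) = eval ψ ξ x := by
        intro x
        rw [he]
        induction x using Induced.induction_on with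
        | h0 => simp
        | ha x y hx hy => simp [hx, hy]
        | ht m s => simp [X, symbol_map, hθ']
      rw [← hX, AddEquiv.apply_symm_apply]
      simp [X]

end UniversalLocalisation

end UniversalLocalisation

section Category

universe w

/-- A (small) index set for the presentations of the objects of a class `E` of right `R`-modules:
the injective maps `α` between finitely generated projective right `R`-modules whose cokernel is
isomorphic to an object of `E`. As every finitely generated module is isomorphic to a quotient of
some `R ^ n`, only such quotients are taken as domains and codomains. -/
structure PresentationIndex {R : Type u} [Ring R]
    (E : CategoryTheory.ObjectProperty (ModuleCat.{u} Rᵐᵒᵖ)) : Type u where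
  m : ℕ
  n : ℕ
  K : Submodule Rᵐᵒᵖ (Fin m → R)
  L : Submodule Rᵐᵒᵖ (Fin n → R)
  projective_dom : Module.Projective Rᵐᵒᵖ ((Fin m → R) ⧸ K)
  projective_cod : Module.Projective Rᵐᵒᵖ ((Fin n → R) ⧸ L)
  α : ((Fin m → R) ⧸ K) →ₗ[Rᵐᵒᵖ] ((Fin n → R) ⧸ L)
  injective : Function.Injective α
  coker_mem : ∃ X : ModuleCat.{u} Rᵐᵒᵖ, E X ∧
    Nonempty ((((Fin n → R) ⧸ L) ⧸ LinearMap.range α) ≃ₗ[Rᵐᵒᵖ] X)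

/-- The universal localisation `R_E` of `R` at a class `E` of finitely presented right `R`-modules
of projective dimension at most one: the universal localisation at the presentations of the
objects of `E`. -/
abbrev UniversalLocalisationAt {R : Type u} [Ring R]
    (E : CategoryTheory.ObjectProperty (ModuleCat.{u} Rᵐᵒᵖ)) : Type u :=
  UniversalLocalisation (fun i : PresentationIndex E => i.α)

namespace UniversalLocalisationAt

/-- The canonical ring homomorphism `R → R_E`. -/
abbrev of {R : Type u} [Ring R]
    (E : CategoryTheory.ObjectProperty (ModuleCat.{u} Rᵐᵒᵖ)) : R →+* UniversalLocalisationAt E :=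
  UniversalLocalisation.of (fun i : PresentationIndex E => i.α)

variable {R : Type u} [Ring R] (E : CategoryTheory.ObjectProperty (ModuleCat.{u} Rᵐᵒᵖ))

theorem finite_quotient {n : ℕ} (K : Submodule Rᵐᵒᵖ (Fin n → R)) :
    Module.Finite Rᵐᵒᵖ ((Fin n → R) ⧸ K) := by
  let u : Rᵐᵒᵖ →ₗ[Rᵐᵒᵖ] R :=
    { toFun := MulOpposite.unop
      map_add' := fun _ _ => rfl
      map_smul' := fun _ _ => rfl }
  have : Module.Finite Rᵐᵒᵖ R := Module.Finite.of_surjective u MulOpposite.unop_surjective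
  infer_instance

theorem exists_equiv_quotient (P : Type*) [AddCommGroup P] [Module Rᵐᵒᵖ P]
    [Module.Finite Rᵐᵒᵖ P] :
    ∃ (n : ℕ) (K : Submodule Rᵐᵒᵖ (Fin n → R)), Nonempty (((Fin n → R) ⧸ K) ≃ₗ[Rᵐᵒᵖ] P) := by
  obtain ⟨n, f, hf⟩ := Module.Finite.exists_fin' Rᵐᵒᵖ P
  let u : R ≃ₗ[Rᵐᵒᵖ] Rᵐᵒᵖ :=
    { MulOpposite.opEquiv with
      map_add' := fun _ _ => rfl
      map_smul' := fun _ _ => rfl }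
  let v : (Fin n → R) ≃ₗ[Rᵐᵒᵖ] (Fin n → Rᵐᵒᵖ) := LinearEquiv.piCongrRight fun _ => u
  exact ⟨n, LinearMap.ker (f ∘ₗ v.toLinearMap),
    ⟨LinearMap.quotKerEquivOfSurjective (f ∘ₗ v.toLinearMap) (hf.comp v.surjective)⟩⟩

/-- Every injective map between finitely generated projective right modules whose cokernel lies
in `E` becomes invertible over `R_E`. -/
theorem map_bijective {P Q : Type*} [AddCommGroup P] [Module Rᵐᵒᵖ P] [AddCommGroup Q]
    [Module Rᵐᵒᵖ Q] [Module.Finite Rᵐᵒᵖ P] [Module.Projective Rᵐᵒᵖ P]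
    [Module.Finite Rᵐᵒᵖ Q] [Module.Projective Rᵐᵒᵖ Q] (f : P →ₗ[Rᵐᵒᵖ] Q)
    (hf : Function.Injective f) (X : ModuleCat.{u} Rᵐᵒᵖ) (hX : E X)
    (c : (Q ⧸ LinearMap.range f) ≃ₗ[Rᵐᵒᵖ] X) :
    Function.Bijective (Induced.map (of E) f) := by
  obtain ⟨m, K, ⟨eP⟩⟩ := exists_equiv_quotient (R := R) P
  obtain ⟨n, L, ⟨eQ⟩⟩ := exists_equiv_quotient (R := R) Q
  have hK := finite_quotient K
  have hL := finite_quotient L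
  have hPK : Module.Projective Rᵐᵒᵖ ((Fin m → R) ⧸ K) := .of_equiv eP.symm
  have hPL : Module.Projective Rᵐᵒᵖ ((Fin n → R) ⧸ L) := .of_equiv eQ.symm
  let a : ((Fin m → R) ⧸ K) →ₗ[Rᵐᵒᵖ] ((Fin n → R) ⧸ L) :=
    eQ.symm.toLinearMap ∘ₗ f ∘ₗ eP.toLinearMap
  have hr : Submodule.map eQ.toLinearMap (LinearMap.range a) = LinearMap.range f := by
    ext y
    constructor
    · rintro ⟨_, ⟨x, rfl⟩, rfl⟩
      exact ⟨eP x, by simp [a]⟩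
    · rintro ⟨x, rfl⟩
      exact ⟨eQ.symm (f x), ⟨eP.symm x, by simp [a]⟩, by simp⟩
  let i : PresentationIndex E :=
    { m := m, n := n, K := K, L := L, projective_dom := hPK, projective_cod := hPL, α := a
      injective := eQ.symm.injective.comp (hf.comp eP.injective)
      coker_mem := ⟨X, hX, ⟨(Submodule.Quotient.equiv _ _ eQ hr).trans c⟩⟩ }
  have hb : Function.Bijective (Induced.map (of E) a) :=
    UniversalLocalisation.map_bijective (fun i : PresentationIndex E => i.α) i
  have hfa : f = eQ.toLinearMap ∘ₗ a ∘ₗ eP.symm.toLinearMap := by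
    ext x
    simp [a]
  have h2 : ⇑(Induced.map (of E) f) = Induced.map (of E) eQ.toLinearMap ∘
      Induced.map (of E) a ∘ Induced.map (of E) eP.symm.toLinearMap := by
    funext x
    conv_lhs => rw [hfa]
    rw [Induced.map_comp, Induced.map_comp]
    rfl
  rw [h2]
  exact (Induced.map_equiv_bijective _ eQ).comp
    (hb.comp (Induced.map_equiv_bijective _ eP.symm))

/-- The universal property of `R_E`. -/
theorem existsUnique_lift {T : Type w} [Ring T] (ψ : R →+* T)
    (hψ : ∀ (P Q : Type u) [AddCommGroup P] [Module Rᵐᵒᵖ P] [AddCommGroup Q] [Module Rᵐᵒᵖ Q]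
      [Module.Finite Rᵐᵒᵖ P] [Module.Projective Rᵐᵒᵖ P]
      [Module.Finite Rᵐᵒᵖ Q] [Module.Projective Rᵐᵒᵖ Q] (f : P →ₗ[Rᵐᵒᵖ] Q),
      Function.Injective f → (∃ X : ModuleCat.{u} Rᵐᵒᵖ, E X ∧
        Nonempty ((Q ⧸ LinearMap.range f) ≃ₗ[Rᵐᵒᵖ] X)) →
      Function.Bijective (Induced.map ψ f)) :
    ∃! θ : UniversalLocalisationAt E →+* T, θ.comp (of E) = ψ := by
  refine UniversalLocalisation.existsUnique_lift _ ψ fun i => ?_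
  have := finite_quotient i.K
  have := finite_quotient i.L
  have := i.projective_dom
  have := i.projective_cod
  exact hψ _ _ i.α i.injective i.coker_mem

end UniversalLocalisationAt

end Category

/-! Call a right `R`-module `W` local if every map `P → W` extends uniquely along each inverted map
`α : P → Q`. The symbols generating `R_E` act on a local module, so every map from `M` to a local
module factors through `M → M ⊗ R_E` (`exists_factor_induced`); moreover `M ⊗ R_E` is itself local
(`induced_isLocal`). Hence `m` dies in `M ⊗ R_E` exactly when every map from `M` to a local module
kills it.

Given an extension `N` of `E₁` by `M` and a map `φ : E₂ → N`, use that a local `W` satisfies `Hom(X,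
W) = 0` and `Ext¹(X, W) = 0` for `X` in `E`. So `M → M ⊗ R_E` extends to `N`, and the extension
vanishes on the image of `φ`.

Conversely, attach copies of the `Q i` to `M` along all maps from the `P i`, countably often. In the
union `X` every map from `P i` extends along `α i`, and dividing `X` by the trace of `E` makes the
extensions unique (`isLocalFor_quotient_traceSubmodule`). If a finitely generated `D ≤ M` dies in `M
⊗ R_E`, it dies in this local quotient, so its image in `X` lies in the image of some `Z → X` with
`Z` essentially in `E`. Since `Z` is finitely presented, this is a finite system of equations over
`M` solved in `X`. Each attachment involves only finitely many cells in any such system, so the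
system is already solvable in an extension of `M` by a module essentially in `E` (`IsCellular`,
`exists_isCellular`). Part (1) takes for `D` the span of `m`, part (2) takes `M` itself. -/

section StableClosure

/-! ### The stable closure of an extension-closed class. -/

variable {A : Type u} [Ring A]

/-- A module `Z` lies in the stable closure of a class `E` if `Z × X` lies in `E` for some `X`
in `E`. If `E` is nonempty and closed under extensions, the stable closure consists of zero and
of the modules isomorphic to an object of `E`. -/
def StablyMem (E : CategoryTheory.ObjectProperty (ModuleCat.{u} A))
    (Z : Type u) [AddCommGroup Z] [Module A Z] : Prop :=
  ∃ X : ModuleCat.{u} A, E X ∧ E (ModuleCat.of A (Z × X))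

variable {E : CategoryTheory.ObjectProperty (ModuleCat.{u} A)}

theorem mem_of_exact [hext : E.IsClosedUnderExtensions] {X Y Z : Type u}
    [AddCommGroup X] [Module A X] [AddCommGroup Y] [Module A Y] [AddCommGroup Z] [Module A Z]
    (f : X →ₗ[A] Y) (g : Y →ₗ[A] Z) (hf : Function.Injective f) (hfg : Function.Exact f g)
    (hg : Function.Surjective g) (hX : E (ModuleCat.of A X)) (hZ : E (ModuleCat.of A Z)) :
    E (ModuleCat.of A Y) := by
  have hS : (CategoryTheory.ShortComplex.mk (ModuleCat.ofHom f) (ModuleCat.ofHom g)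
      (by ext x; exact hfg.apply_apply_eq_zero x)).ShortExact :=
    { exact := (CategoryTheory.ShortComplex.ShortExact.moduleCat_exact_iff_function_exact _).2 hfg
      mono_f := (ModuleCat.mono_iff_injective _).2 hf
      epi_g := (ModuleCat.epi_iff_surjective _).2 hg }
  exact E.prop_X₂_of_shortExact hS hX hZ

theorem mem_prod [E.IsClosedUnderExtensions] {X Y : Type u}
    [AddCommGroup X] [Module A X] [AddCommGroup Y] [Module A Y]
    (hX : E (ModuleCat.of A X)) (hY : E (ModuleCat.of A Y)) : E (ModuleCat.of A (X × Y)) :=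
  mem_of_exact (LinearMap.inl A X Y) (LinearMap.snd A X Y) LinearMap.inl_injective
    .inl_snd LinearMap.snd_surjective hX hY

namespace StablyMem

theorem of_mem [E.IsClosedUnderExtensions] {X : ModuleCat.{u} A} (hX : E X) : StablyMem E X :=
  ⟨X, hX, mem_prod hX hX⟩

/-- Adding the split sequence `U → U × V → V` to the given one puts both outer terms into `E`. -/
theorem of_exact [E.IsClosedUnderExtensions] {X Y Z : Type u}
    [AddCommGroup X] [Module A X] [AddCommGroup Y] [Module A Y] [AddCommGroup Z] [Module A Z]
    (f : X →ₗ[A] Y) (g : Y →ₗ[A] Z) (hf : Function.Injective f) (hfg : Function.Exact f g)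
    (hg : Function.Surjective g) (hX : StablyMem E X) (hZ : StablyMem E Z) : StablyMem E Y := by
  obtain ⟨U, hU, hXU⟩ := hX
  obtain ⟨V, hV, hZV⟩ := hZ
  refine ⟨ModuleCat.of A (U × V), mem_prod hU hV, ?_⟩
  refine mem_of_exact (f.prodMap (LinearMap.inl A U V)) (g.prodMap (LinearMap.snd A U V))
    ?_ ?_ ?_ hXU hZV
  · exact hf.prodMap LinearMap.inl_injective
  · rintro ⟨y, u, v⟩
    constructor
    · intro h
      simp only [LinearMap.prodMap_apply, LinearMap.snd_apply, Prod.mk_eq_zero] at h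
      obtain ⟨x, rfl⟩ := (hfg y).1 h.1
      exact ⟨(x, u), by simp [h.2]⟩
    · rintro ⟨⟨x, w⟩, h⟩
      simp only [LinearMap.prodMap_apply, LinearMap.inl_apply, Prod.mk.injEq] at h
      obtain ⟨rfl, rfl, rfl⟩ := h
      simp [hfg.apply_apply_eq_zero]
  · exact hg.prodMap (LinearMap.snd_surjective (R := A) (M := U) (M₂ := V))

/-- This is the reason for passing to the stable closure: `E` need not contain a zero module, but `Z
× (X × X)` is an extension of `X` by `X`. -/
theorem of_subsingleton [E.IsClosedUnderExtensions] (hne : E.Nonempty) (Z : Type u)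
    [AddCommGroup Z] [Module A Z] [Subsingleton Z] : StablyMem E Z := by
  obtain ⟨X, hX⟩ := hne
  refine ⟨ModuleCat.of A (X × X), mem_prod hX hX, ?_⟩
  refine mem_of_exact ((LinearMap.inr A Z (X × X)) ∘ₗ LinearMap.inl A X X)
    (LinearMap.snd A X X ∘ₗ LinearMap.snd A Z (X × X))
    (fun x y h => by simpa using h) ?_ (fun x => ⟨(0, 0, x), rfl⟩) hX hX
  rintro ⟨z, x, y⟩
  obtain rfl := Subsingleton.elim z 0
  simp [eq_comm]

/-- An isomorphism is an extension with zero quotient, so isomorphism invariance follows once zero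
is available. -/
theorem of_equiv [E.IsClosedUnderExtensions] (hne : E.Nonempty) {X Y : Type u}
    [AddCommGroup X] [Module A X] [AddCommGroup Y] [Module A Y] (e : X ≃ₗ[A] Y)
    (hX : StablyMem E X) : StablyMem E Y :=
  of_exact e.toLinearMap (0 : Y →ₗ[A] PUnit.{u + 1}) e.injective
    (fun y => ⟨fun _ => e.surjective y, fun _ => rfl⟩) (fun _ => ⟨0, rfl⟩) hX
    (of_subsingleton hne PUnit)

theorem prod [E.IsClosedUnderExtensions] {X Y : Type u}
    [AddCommGroup X] [Module A X] [AddCommGroup Y] [Module A Y]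
    (hX : StablyMem E X) (hY : StablyMem E Y) : StablyMem E (X × Y) :=
  of_exact (LinearMap.inl A X Y) (LinearMap.snd A X Y) LinearMap.inl_injective
    .inl_snd LinearMap.snd_surjective hX hY

theorem pi [E.IsClosedUnderExtensions] (hne : E.Nonempty) {κ : Type u} [Finite κ]
    (Z : κ → Type u) [∀ k, AddCommGroup (Z k)] [∀ k, Module A (Z k)]
    (hZ : ∀ k, StablyMem E (Z k)) : StablyMem E (∀ k, Z k) :=
  Module.pi_induction' A (fun Z _ _ => StablyMem E Z)
    (fun Z _ _ => StablyMem E Z) (fun e h => of_equiv hne e h)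
    (fun e h => of_equiv hne e h) (of_subsingleton hne _) (fun h h' => prod h h') Z hZ

/-- `Z` is the quotient of the finitely presented `Z × X` by the finitely generated `0 × X`. -/
theorem finitePresentation (hfp : ∀ X, E X → Module.FinitePresentation A X) {Z : Type u}
    [AddCommGroup Z] [Module A Z] (hZ : StablyMem E Z) : Module.FinitePresentation A Z := by
  obtain ⟨X, hX, hZX⟩ := hZ
  have h1 : Module.FinitePresentation A (Z × X) := hfp _ hZX
  have h2 := hfp _ hX
  refine Module.finitePresentation_of_surjective (LinearMap.fst A Z X)
    LinearMap.fst_surjective ?_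
  rw [LinearMap.ker_fst]
  rw [← Submodule.map_top]
  exact Module.Finite.fg_top.map _

end StablyMem

end StableClosure

/-! ### Pushouts of modules. -/

section Pushout

variable {A : Type*} [Ring A]

theorem LinearMap.exists_factor_of_ker_le {X Y Z : Type*} [AddCommGroup X] [Module A X]
    [AddCommGroup Y] [Module A Y] [AddCommGroup Z] [Module A Z] (p : X →ₗ[A] Y)
    (hp : Function.Surjective p) (f : X →ₗ[A] Z) (h : ∀ x, p x = 0 → f x = 0) :
    ∃ g : Y →ₗ[A] Z, ∀ x, g (p x) = f x :=
  ⟨(LinearMap.ker p).liftQ f (fun x hx => h x hx) ∘ₗ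
    (p.quotKerEquivOfSurjective hp).symm.toLinearMap, fun x => by
      have : (p.quotKerEquivOfSurjective hp).symm (p x) = (LinearMap.ker p).mkQ x := by
        rw [LinearEquiv.symm_apply_eq]; rfl
      simp only [LinearMap.comp_apply, LinearEquiv.coe_coe, this]
      exact Submodule.liftQ_apply _ _ _⟩

/-- The pushout of `g : P → N` along `α : P → Q`. -/
abbrev ModulePushout {P Q N : Type*} [AddCommGroup P] [Module A P] [AddCommGroup Q] [Module A Q]
    [AddCommGroup N] [Module A N] (g : P →ₗ[A] N) (α : P →ₗ[A] Q) :=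
  (N × Q) ⧸ LinearMap.range (g.prod (-α))

namespace ModulePushout

variable {P Q N X : Type*} [AddCommGroup P] [Module A P] [AddCommGroup Q] [Module A Q]
    [AddCommGroup N] [Module A N] [AddCommGroup X] [Module A X] (g : P →ₗ[A] N) (α : P →ₗ[A] Q)

/-- The canonical map from the first module to the pushout. -/
def inl : N →ₗ[A] ModulePushout g α := Submodule.mkQ _ ∘ₗ LinearMap.inl A N Q

/-- The canonical map from the second module to the pushout. -/
def inr : Q →ₗ[A] ModulePushout g α := Submodule.mkQ _ ∘ₗ LinearMap.inr A N Q

theorem mk_eq (x : N × Q) :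
    (LinearMap.range (g.prod (-α))).mkQ x = inl g α x.1 + inr g α x.2 := by
  simp only [inl, inr, LinearMap.comp_apply, ← map_add]
  simp

theorem exists_rep (z : ModulePushout g α) : ∃ n q, z = inl g α n + inr g α q := by
  obtain ⟨x, rfl⟩ := Submodule.mkQ_surjective _ z
  exact ⟨x.1, x.2, mk_eq g α x⟩

theorem inl_add_inr_eq_zero (n : N) (q : Q) :
    inl g α n + inr g α q = 0 ↔ ∃ p, g p = n ∧ - α p = q := by
  rw [← mk_eq g α (n, q), Submodule.mkQ_apply, Submodule.Quotient.mk_eq_zero]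
  simp

theorem inl_apply (p : P) : inl g α (g p) = inr g α (α p) := by
  rw [← sub_eq_zero, sub_eq_add_neg, ← map_neg, inl_add_inr_eq_zero]
  exact ⟨p, rfl, rfl⟩

theorem inl_injective (hα : Function.Injective α) : Function.Injective (inl g α) := by
  rw [injective_iff_map_eq_zero]
  intro n hn
  obtain ⟨p, rfl, hp⟩ := (inl_add_inr_eq_zero g α n 0).1 (by simpa using hn)
  rw [neg_eq_zero] at hp
  rw [hα (hp.trans (map_zero α).symm), map_zero]

variable {g α} in
theorem exists_desc (f : N →ₗ[A] X) (k : Q →ₗ[A] X) (h : ∀ p, f (g p) = k (α p)) :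
    ∃ d : ModulePushout g α →ₗ[A] X, (∀ n, d (inl g α n) = f n) ∧ ∀ q, d (inr g α q) = k q := by
  refine ⟨Submodule.liftQ _ (f.coprod k) ?_, fun n => ?_, fun q => ?_⟩
  · rintro _ ⟨p, rfl⟩
    simp [h]
  · simp [inl]
  · simp [inr]

end ModulePushout

end Pushout

/-! ### Cokernels in the stable closure. -/

section Cokernels

variable {A : Type u} [Ring A] {E : CategoryTheory.ObjectProperty (ModuleCat.{u} A)}
  [E.IsClosedUnderExtensions]

/-- The exact sequence `0 → N/M → N'/M → N'/N → 0`. -/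
theorem StablyMem.coker_comp {M N N' : Type u} [AddCommGroup M] [Module A M] [AddCommGroup N]
    [Module A N] [AddCommGroup N'] [Module A N'] (i : M →ₗ[A] N) (f : N →ₗ[A] N')
    (hf : Function.Injective f) (hi : StablyMem E (N ⧸ LinearMap.range i))
    (hfE : StablyMem E (N' ⧸ LinearMap.range f)) :
    StablyMem E (N' ⧸ LinearMap.range (f ∘ₗ i)) := by
  refine of_exact (Submodule.mapQ (LinearMap.range i) (LinearMap.range (f ∘ₗ i)) f ?_)
    (Submodule.factor (LinearMap.range_comp_le_range i f)) ?_ ?_ ?_ hi hfE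
  · rintro _ ⟨x, rfl⟩
    exact ⟨x, rfl⟩
  · rw [injective_iff_map_eq_zero]
    intro x hx
    obtain ⟨x, rfl⟩ := Submodule.mkQ_surjective _ x
    simp only [Submodule.mkQ_apply, Submodule.mapQ_apply, Submodule.Quotient.mk_eq_zero] at hx ⊢
    obtain ⟨m, hm⟩ := hx
    exact ⟨m, hf hm⟩
  · intro y
    obtain ⟨y, rfl⟩ := Submodule.mkQ_surjective _ y
    constructor
    · intro h
      rw [Submodule.factor_mk, Submodule.mkQ_apply, Submodule.Quotient.mk_eq_zero] at h
      obtain ⟨n, rfl⟩ := h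
      exact ⟨Submodule.mkQ _ n, rfl⟩
    · rintro ⟨n, hn⟩
      obtain ⟨n, rfl⟩ := Submodule.mkQ_surjective _ n
      rw [← hn]
      simp
  · exact Submodule.factor_surjective _

/-- A pushout does not change the cokernel: `inr` induces an isomorphism from the cokernel of `α`.
-/
theorem StablyMem.coker_inl (hne : E.Nonempty) {P Q N : Type u} [AddCommGroup P] [Module A P]
    [AddCommGroup Q] [Module A Q] [AddCommGroup N] [Module A N] (g : P →ₗ[A] N) (α : P →ₗ[A] Q)
    (hα : StablyMem E (Q ⧸ LinearMap.range α)) :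
    StablyMem E (ModulePushout g α ⧸ LinearMap.range (ModulePushout.inl g α)) := by
  let f : Q →ₗ[A] (ModulePushout g α ⧸ LinearMap.range (ModulePushout.inl g α)) :=
    Submodule.mkQ _ ∘ₗ ModulePushout.inr g α
  have hf : Function.Surjective f := by
    intro z
    obtain ⟨z, rfl⟩ := Submodule.mkQ_surjective _ z
    obtain ⟨n, q, rfl⟩ := ModulePushout.exists_rep g α z
    refine ⟨q, ?_⟩
    simp [f]
  have hk : LinearMap.range α = LinearMap.ker f := by
    ext q
    simp only [f, LinearMap.mem_ker, LinearMap.comp_apply, Submodule.mkQ_apply,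
      Submodule.Quotient.mk_eq_zero]
    constructor
    · rintro ⟨p, rfl⟩
      exact ⟨g p, ModulePushout.inl_apply g α p⟩
    · rintro ⟨n, hn⟩
      obtain ⟨p, -, hp⟩ := (ModulePushout.inl_add_inr_eq_zero g α n (-q)).1 (by simp [hn])
      exact ⟨p, neg_injective hp⟩
  exact of_equiv hne ((Submodule.quotEquivOfEq _ _ hk).trans (f.quotKerEquivOfSurjective hf)) hα

theorem StablyMem.coker_pi (hne : E.Nonempty) {κ : Type u} [Finite κ] (P Q : κ → Type u)
    [∀ k, AddCommGroup (P k)] [∀ k, Module A (P k)] [∀ k, AddCommGroup (Q k)]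
    [∀ k, Module A (Q k)] (α : ∀ k, P k →ₗ[A] Q k)
    (hα : ∀ k, StablyMem E (Q k ⧸ LinearMap.range (α k))) :
    StablyMem E ((∀ k, Q k) ⧸ LinearMap.range (LinearMap.piMap α)) := by
  let f : (∀ k, Q k) →ₗ[A] (∀ k, Q k ⧸ LinearMap.range (α k)) :=
    LinearMap.piMap fun k => Submodule.mkQ _
  have hf : Function.Surjective f := Function.Surjective.piMap fun k => Submodule.mkQ_surjective _
  have hk : LinearMap.ker f = LinearMap.range (LinearMap.piMap α) := by
    ext q
    have h : f q = 0 ↔ ∀ k, ∃ p, α k p = q k := by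
      rw [funext_iff]
      exact forall_congr' fun k => Submodule.Quotient.mk_eq_zero _
    rw [LinearMap.mem_ker, h]
    constructor
    · intro h
      choose p hp using h
      exact ⟨p, funext hp⟩
    · rintro ⟨p, rfl⟩ k
      exact ⟨p k, rfl⟩
  exact of_equiv hne ((f.quotKerEquivOfSurjective hf).symm.trans (Submodule.quotEquivOfEq _ _ hk))
    (pi hne _ hα)

end Cokernels

/-! ### Reduction of direct sums to finitely many summands. -/

section DirectSumSupport

open scoped DirectSum

variable {A : Type*} [Ring A] {J : Type*} {P Q : J → Type*}
  [∀ j, AddCommGroup (P j)] [∀ j, Module A (P j)] [∀ j, AddCommGroup (Q j)] [∀ j, Module A (Q j)]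

/-- The union of the supports of the images of finitely many generators works. -/
theorem exists_finset_support_le {G : Type*} [AddCommGroup G] [Module A G] [Module.Finite A G]
    (f : G →ₗ[A] ⨁ j, P j) : ∃ T : Finset J, ∀ g, ∀ j ∉ T, f g j = 0 := by
  classical
  obtain ⟨S, hS⟩ := Module.Finite.fg_top (R := A) (M := G)
  refine ⟨S.biUnion fun g => DFinsupp.support (f g), fun g j hj => ?_⟩
  have h : (⊤ : Submodule A G) ≤ LinearMap.ker (DirectSum.component A J P j ∘ₗ f) := by
    rw [← hS, Submodule.span_le]
    intro s hs
    by_contra h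
    exact hj (Finset.mem_biUnion.2 ⟨s, hs, DFinsupp.mem_support_iff.2 h⟩)
  exact h Submodule.mem_top

/-- The projection of a direct sum onto the product over a finite set of indices. -/
def finsetProj (A : Type*) [Ring A] {J : Type*} (P : J → Type*) [∀ j, AddCommGroup (P j)] [∀ j, Module A (P j)] (T : Finset J) :
    (⨁ j, P j) →ₗ[A] ∀ t : T, P t :=
  LinearMap.pi fun t => DirectSum.component A J P t

open Classical in
/-- The inclusion of a product over a finite set of indices into the direct sum. -/
noncomputable def finsetIncl (A : Type*) [Ring A] {J : Type*} (P : J → Type*) [∀ j, AddCommGroup (P j)] [∀ j, Module A (P j)]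
    (T : Finset J) : (∀ t : T, P t) →ₗ[A] ⨁ j, P j :=
  ∑ t : T, DirectSum.lof A J P t ∘ₗ LinearMap.proj t

theorem finsetIncl_finsetProj (T : Finset J) (x : ⨁ j, P j) (hx : ∀ j ∉ T, x j = 0) :
    finsetIncl A P T (finsetProj A P T x) = x := by
  classical
  have h : DFinsupp.support x ⊆ T := by
    intro j hj
    by_contra h
    exact DFinsupp.mem_support_iff.1 hj (hx j h)
  have h2 : ∑ j ∈ T, DirectSum.of P j (x j) = x := by
    rw [← Finset.sum_subset h]
    · exact DirectSum.sum_support_of x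
    · intro j _ hj
      rw [DFinsupp.notMem_support_iff.1 hj, map_zero]
  conv_rhs => rw [← h2, ← Finset.sum_coe_sort]
  simp only [finsetIncl, LinearMap.sum_apply]
  refine Finset.sum_congr rfl fun t _ => ?_
  rfl

theorem lmap_finsetIncl (α : ∀ j, P j →ₗ[A] Q j) (T : Finset J) (p : ∀ t : T, P t) :
    DirectSum.lmap α (finsetIncl A P T p) =
      finsetIncl A Q T (LinearMap.piMap (fun t : T => α t) p) := by
  simp only [finsetIncl, LinearMap.sum_apply, map_sum, LinearMap.comp_apply]
  refine Finset.sum_congr rfl fun t _ => ?_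
  rw [DirectSum.lmap_lof]
  rfl

end DirectSumSupport

/-! ### Cellular maps and the attachment of cells. -/

section CellularMaps

open scoped DirectSum

variable {A : Type u} [Ring A]

/-- A map `j : M → X` is `E`-cellular if every finite system of equations over `M` solved in `X`
is already solved in an extension of a module in the stable closure of `E` by `M` which maps to
`X`. -/
def IsCellular (E : CategoryTheory.ObjectProperty (ModuleCat.{u} A)) {M X : Type u}
    [AddCommGroup M] [Module A M] [AddCommGroup X] [Module A X] (j : M →ₗ[A] X) : Prop :=
  ∀ (G : Type u) [AddCommGroup G] [Module A G] [Module.Finite A G] [Module.Projective A G]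
    (x : G →ₗ[A] X) (κ : Type) [Finite κ] (m : κ → M) (g : κ → G),
    (∀ k, j (m k) + x (g k) = 0) →
    ∃ (N : Type u) (_ : AddCommGroup N) (_ : Module A N)
      (i : M →ₗ[A] N) (y : G →ₗ[A] N) (h : N →ₗ[A] X),
      Function.Injective i ∧ StablyMem E (N ⧸ LinearMap.range i) ∧
      (∀ m, h (i m) = j m) ∧ (∀ g, h (y g) = x g) ∧ ∀ k, i (m k) + y (g k) = 0

variable {E : CategoryTheory.ObjectProperty (ModuleCat.{u} A)} [E.IsClosedUnderExtensions]

theorem IsCellular.id (hne : E.Nonempty) {M : Type u} [AddCommGroup M] [Module A M] :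
    IsCellular E (LinearMap.id : M →ₗ[A] M) := by
  intro G _ _ _ _ x κ _ m g h
  refine ⟨M, inferInstance, inferInstance, .id, x, .id, fun _ _ h => h, ?_, fun _ => rfl,
    fun _ => rfl, h⟩
  have : Subsingleton (M ⧸ LinearMap.range (LinearMap.id : M →ₗ[A] M)) := by
    rw [LinearMap.range_id]
    infer_instance
  exact .of_subsingleton hne _

variable {ι : Type u} {P Q : ι → Type u}
  [∀ i, AddCommGroup (P i)] [∀ i, Module A (P i)]
  [∀ i, AddCommGroup (Q i)] [∀ i, Module A (Q i)] (α : ∀ i, P i →ₗ[A] Q i)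

open Classical in
/-- The sum of all maps from the modules `P i` to `X`. -/
noncomputable def attachingMap (A : Type u) [Ring A] {ι : Type u} (P : ι → Type u) [∀ i, AddCommGroup (P i)] [∀ i, Module A (P i)]
    (X : Type u) [AddCommGroup X] [Module A X] :
    (⨁ z : Σ i, P i →ₗ[A] X, P z.1) →ₗ[A] X :=
  DirectSum.toModule A _ X fun z => z.2

/-- The module obtained from `X` by attaching a copy of `Q i` along every map `P i → X`. -/
abbrev CellAttachment (X : Type u) [AddCommGroup X] [Module A X] : Type u :=
  ModulePushout (attachingMap A P X) (DirectSum.lmap fun z : Σ i, P i →ₗ[A] X => α z.1)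

namespace CellAttachment

/-- The canonical map to the cell attachment. -/
noncomputable abbrev of (X : Type u) [AddCommGroup X] [Module A X] : X →ₗ[A] CellAttachment α X :=
  ModulePushout.inl _ _

theorem of_injective (hα : ∀ i, Function.Injective (α i)) (X : Type u) [AddCommGroup X]
    [Module A X] : Function.Injective (of α X) :=
  ModulePushout.inl_injective _ _ ((DirectSum.lmap_injective _).2 fun z => hα z.1)

theorem exists_extension (X : Type u) [AddCommGroup X] [Module A X] (i : ι) (f : P i →ₗ[A] X) :
    ∃ g : Q i →ₗ[A] CellAttachment α X, ∀ p, g (α i p) = of α X (f p) := by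
  classical
  refine ⟨ModulePushout.inr _ _ ∘ₗ
    DirectSum.lof A (Σ i, P i →ₗ[A] X) (fun z => Q z.1) ⟨i, f⟩, fun p => ?_⟩
  have h1 := ModulePushout.inl_apply (attachingMap A P X)
    (DirectSum.lmap fun z : Σ i, P i →ₗ[A] X => α z.1)
    (DirectSum.lof A (Σ i, P i →ₗ[A] X) (fun z => P z.1) ⟨i, f⟩ p)
  rw [DirectSum.lmap_lof] at h1
  rw [LinearMap.comp_apply, ← h1]
  congr 1
  unfold attachingMap
  exact DirectSum.toModule_lof A (M := fun z : Σ i, P i →ₗ[A] X => P z.1) (φ := fun z => z.2)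
    ⟨i, f⟩ p

end CellAttachment

/-- A system solved in the cell attachment uses finitely many cells. It is traded for a system over
`X` whose unknowns include the finitely many `P i` concerned; this is why the unknowns in
`IsCellular` form a finitely generated projective module. After solving that system in an extension
`N` of `M`, the same cells are attached to `N`. -/
theorem IsCellular.comp_of (hne : E.Nonempty) [∀ i, Module.Finite A (P i)]
    [∀ i, Module.Projective A (P i)] (hα : ∀ i, Function.Injective (α i))
    (hαE : ∀ i, StablyMem E (Q i ⧸ LinearMap.range (α i)))
    {M X : Type u} [AddCommGroup M] [Module A M] [AddCommGroup X] [Module A X]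
    (j : M →ₗ[A] X) (hj : IsCellular E j) : IsCellular E (CellAttachment.of α X ∘ₗ j) := by
  classical
  intro G _ _ _ _ x κ _ m g hmg
  set γ := attachingMap A P X
  set αs := DirectSum.lmap fun z : Σ i, P i →ₗ[A] X => α z.1
  obtain ⟨x', hx'⟩ := Module.projective_lifting_property
    (LinearMap.range (γ.prod (-αs))).mkQ x (Submodule.mkQ_surjective _)
  let y : G →ₗ[A] X := LinearMap.fst _ _ _ ∘ₗ x'
  let q : G →ₗ[A] ⨁ z : Σ i, P i →ₗ[A] X, Q z.1 := LinearMap.snd _ _ _ ∘ₗ x'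
  have hx : ∀ g, x g = ModulePushout.inl γ αs (y g) + ModulePushout.inr γ αs (q g) := by
    intro g
    rw [← hx', LinearMap.comp_apply, ModulePushout.mk_eq]
    rfl
  -- An equation holds in the pushout because its two components come from a common element of the
  -- direct sum of the `P i`.
  have hrel : ∀ k, ∃ p, γ p = j (m k) + y (g k) ∧ - αs p = q (g k) := by
    intro k
    rw [← ModulePushout.inl_add_inr_eq_zero, map_add, add_assoc, ← hx]
    exact hmg k
  choose p hp1 hp2 using hrel
  have := Fintype.ofFinite κ
  obtain ⟨T₀, hT₀⟩ := exists_finset_support_le q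
  -- The finitely many cells met by the values of `q` and by the witnesses `p k`.
  let T := T₀ ∪ Finset.univ.biUnion fun k => DFinsupp.support (p k)
  have hTq : ∀ g, finsetIncl A _ T (finsetProj A _ T (q g)) = q g := fun g =>
    finsetIncl_finsetProj _ _ fun z hz => hT₀ g z fun h => hz (Finset.mem_union_left _ h)
  have hTp : ∀ k, finsetIncl A _ T (finsetProj A _ T (p k)) = p k := fun k =>
    finsetIncl_finsetProj _ _ fun z hz => by
      by_contra h
      exact hz (Finset.mem_union_right _ (Finset.mem_biUnion.2
        ⟨k, Finset.mem_univ _, DFinsupp.mem_support_iff.2 h⟩))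
  let PT := ∀ t : T, P t.1.1
  let αT : PT →ₗ[A] ∀ t : T, Q t.1.1 := LinearMap.piMap fun t => α t.1.1
  have : Module.Projective A PT := by
    refine Module.Projective.of_equiv
      (DirectSum.linearEquivFunOnFintype A T (fun t => P t.1.1))
  -- The system handed to `hj` is `j (m k) + y (g k) - γ (p k) = 0`. Its solution `y'` restricts on
  -- `PT` to the attaching map `g'` for the new cells.
  obtain ⟨N, _, _, i, y', h, hi, hiE, hij, hhy, hrel⟩ :=
    hj (PT × G) ((γ ∘ₗ finsetIncl A _ T).coprod y) κ m (fun k => (- finsetProj A _ T (p k), g k)) (by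
      intro k
      simp only [LinearMap.coprod_apply, LinearMap.comp_apply, map_neg, hTp, hp1]
      abel)
  have hαT : Function.Injective αT := Function.Injective.piMap fun t => hα t.1.1
  let g' : PT →ₗ[A] N := y' ∘ₗ LinearMap.inl _ _ _
  obtain ⟨d, hd1, hd2⟩ := ModulePushout.exists_desc (g := g') (α := αT)
    (CellAttachment.of α X ∘ₗ h) (ModulePushout.inr γ αs ∘ₗ
      finsetIncl A (fun z : Σ i, P i →ₗ[A] X => Q z.1) T) (by
      intro p
      have h1 := ModulePushout.inl_apply γ αs (finsetIncl A _ T p)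
      rw [lmap_finsetIncl] at h1
      simp only [g', LinearMap.comp_apply, hhy, LinearMap.inl_apply, LinearMap.coprod_apply,
        map_zero, add_zero]
      exact h1)
  refine ⟨ModulePushout g' αT, inferInstance, inferInstance, ModulePushout.inl g' αT ∘ₗ i,
    ModulePushout.inl g' αT ∘ₗ y' ∘ₗ LinearMap.inr _ _ _ +
      ModulePushout.inr g' αT ∘ₗ finsetProj A _ T ∘ₗ q, d,
    (ModulePushout.inl_injective _ _ hαT).comp hi,
    .coker_comp i _ (ModulePushout.inl_injective _ _ hαT) hiE
      (.coker_inl hne _ _ (.coker_pi hne _ _ _ fun t => hαE t.1.1)), fun m => ?_, fun g => ?_,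
    fun k => ?_⟩
  · simp [hd1, hij]
  · simp [hd1, hd2, hhy, hTq, hx]
    rfl
  · have h1 := hrel k
    have h2 : (-finsetProj A _ T (p k), g k) =
      LinearMap.inr A PT G (g k) - LinearMap.inl A PT G (finsetProj A _ T (p k)) := by
      simp
    rw [h2, map_sub, ← add_sub_assoc, sub_eq_zero] at h1
    have h3 : finsetProj A _ T (q (g k)) = - αT (finsetProj A _ T (p k)) := by
      rw [← hp2, map_neg]
      rfl
    simp only [LinearMap.add_apply, LinearMap.comp_apply, ← add_assoc]
    rw [← map_add, h1, h3, map_neg, ← sub_eq_add_neg, sub_eq_zero]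
    exact ModulePushout.inl_apply g' αT _

end CellularMaps

/-! ### The union of iterated cell attachments. -/

section Tower

variable {A : Type u} [Ring A] {E : CategoryTheory.ObjectProperty (ModuleCat.{u} A)}
  [E.IsClosedUnderExtensions]

theorem LinearMap.range_le_of_finite_of_monotone {G X : Type*} [AddCommGroup G] [Module A G]
    [Module.Finite A G] [AddCommGroup X] [Module A X] (f : G →ₗ[A] X) (s : ℕ → Submodule A X)
    (hs : Monotone s) (h : ∀ x, ∃ n, x ∈ s n) : ∃ n, LinearMap.range f ≤ s n := by
  obtain ⟨S, hS⟩ := Module.Finite.fg_top (R := A) (M := G)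
  choose n hn using fun g => h (f g)
  refine ⟨S.sup n, ?_⟩
  rw [LinearMap.range_eq_map, ← hS, Submodule.map_span, Submodule.span_le]
  rintro _ ⟨g, hg, rfl⟩
  exact hs (Finset.le_sup hg) (hn g)

theorem LinearMap.exists_lift_of_range_le {G Y X : Type*} [AddCommGroup G] [Module A G]
    [Module.Projective A G] [AddCommGroup Y] [Module A Y] [AddCommGroup X] [Module A X]
    (f : G →ₗ[A] X) (h : Y →ₗ[A] X) (hf : LinearMap.range f ≤ LinearMap.range h) :
    ∃ g : G →ₗ[A] Y, ∀ x, h (g x) = f x := by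
  obtain ⟨g, hg⟩ := Module.projective_lifting_property h.rangeRestrict
    (f.codRestrict (LinearMap.range h) fun x => hf ⟨x, rfl⟩) h.surjective_rangeRestrict
  exact ⟨g, fun x => congrArg Subtype.val (LinearMap.congr_fun hg x)⟩

variable {ι : Type u} {P Q : ι → Type u}
  [∀ i, AddCommGroup (P i)] [∀ i, Module A (P i)]
  [∀ i, AddCommGroup (Q i)] [∀ i, Module A (Q i)] (α : ∀ i, P i →ₗ[A] Q i)

/-- The iterated cell attachments of a module. -/
noncomputable def cellTower (M : ModuleCat.{u} A) : ℕ → ModuleCat.{u} A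
  | 0 => M
  | n + 1 => ModuleCat.of A (CellAttachment α (cellTower M n))

/-- The sequence of iterated cell attachments of a module, as a functor. -/
noncomputable def cellTowerFunctor (M : ModuleCat.{u} A) :
    CategoryTheory.Functor ℕ (ModuleCat.{u} A) :=
  CategoryTheory.Functor.ofSequence (X := cellTower α M)
    fun n => ModuleCat.ofHom (CellAttachment.of α (cellTower α M n))

/-- The transition maps between the iterated cell attachments of a module. -/
noncomputable def cellTowerMap (M : ModuleCat.{u} A) (m n : ℕ) (h : m ≤ n) :
    cellTower α M m →ₗ[A] cellTower α M n :=
  ((cellTowerFunctor α M).map (CategoryTheory.homOfLE h)).hom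

theorem cellTowerMap_self (M : ModuleCat.{u} A) (n : ℕ) :
    cellTowerMap α M n n le_rfl = LinearMap.id :=
  congrArg ModuleCat.Hom.hom ((cellTowerFunctor α M).map_id n)

theorem cellTowerMap_comp (M : ModuleCat.{u} A) (k m n : ℕ) (h : k ≤ m) (h' : m ≤ n) :
    cellTowerMap α M m n h' ∘ₗ cellTowerMap α M k m h = cellTowerMap α M k n (h.trans h') :=
  (congrArg ModuleCat.Hom.hom ((cellTowerFunctor α M).map_comp (CategoryTheory.homOfLE h)
    (CategoryTheory.homOfLE h'))).symm

theorem cellTowerMap_succ (M : ModuleCat.{u} A) (n : ℕ) :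
    cellTowerMap α M n (n + 1) n.le_succ = CellAttachment.of α (cellTower α M n) :=
  congrArg ModuleCat.Hom.hom (CategoryTheory.Functor.ofSequence_map_homOfLE_succ _ n)

instance (M : ModuleCat.{u} A) :
    DirectedSystem (fun n => cellTower α M n) (cellTowerMap α M · · ·) where
  map_self n x := by rw [cellTowerMap_self]; rfl
  map_map _ _ _ h h' x := LinearMap.congr_fun (cellTowerMap_comp α M _ _ _ h h') x

theorem cellTowerMap_injective (hα : ∀ i, Function.Injective (α i)) (M : ModuleCat.{u} A)
    (m n : ℕ) (h : m ≤ n) : Function.Injective (cellTowerMap α M m n h) := by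
  induction n, h using Nat.le_induction with
  | base => rw [cellTowerMap_self]; exact Function.injective_id
  | succ n h ih =>
    rw [← cellTowerMap_comp α M m n (n + 1) h n.le_succ, cellTowerMap_succ]
    exact (CellAttachment.of_injective α hα _).comp ih

theorem isCellular_cellTowerMap (hne : E.Nonempty) [∀ i, Module.Finite A (P i)]
    [∀ i, Module.Projective A (P i)] (hα : ∀ i, Function.Injective (α i))
    (hαE : ∀ i, StablyMem E (Q i ⧸ LinearMap.range (α i))) (M : ModuleCat.{u} A) (n : ℕ) :
    IsCellular E (cellTowerMap α M 0 n n.zero_le) := by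
  induction n with
  | zero => rw [cellTowerMap_self]; exact .id hne
  | succ n ih =>
    rw [← cellTowerMap_comp α M 0 n (n + 1) n.zero_le n.le_succ, cellTowerMap_succ]
    exact ih.comp_of α hne hα hαE

/-- Every module has a cellular map to a module into which all maps from the `P i` extend along
`α i`. -/
theorem exists_isCellular (hne : E.Nonempty) [∀ i, Module.Finite A (P i)]
    [∀ i, Module.Projective A (P i)] (hα : ∀ i, Function.Injective (α i))
    (hαE : ∀ i, StablyMem E (Q i ⧸ LinearMap.range (α i)))
    (M : Type u) [AddCommGroup M] [Module A M] :
    ∃ (X : Type u) (_ : AddCommGroup X) (_ : Module A X) (j : M →ₗ[A] X), IsCellular E j ∧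
      ∀ i (f : P i →ₗ[A] X), ∃ g : Q i →ₗ[A] X, ∀ p, g (α i p) = f p := by
  let F := cellTower α (ModuleCat.of A M)
  let φ := cellTowerMap α (ModuleCat.of A M)
  let X := Module.DirectLimit (fun n => F n) φ
  let c : ∀ n, F n →ₗ[A] X := fun n => Module.DirectLimit.of A ℕ (fun n => F n) φ n
  have hc : ∀ m n h x, c n (φ m n h x) = c m x := fun m n h x => Module.DirectLimit.of_f
  -- Injectivity lets an equation that holds in the limit be checked at a finite stage.
  have hci : ∀ n, Function.Injective (c n) := fun n => by
    rw [injective_iff_map_eq_zero]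
    intro x hx
    obtain ⟨m, h, hm⟩ := Module.DirectLimit.of.zero_exact hx
    exact cellTowerMap_injective α hα _ n m h (hm.trans (map_zero _).symm)
  have hmono : Monotone fun n => LinearMap.range (c n) := by
    rintro m n h _ ⟨x, rfl⟩
    exact ⟨φ m n h x, hc _ _ _ _⟩
  have hlift : ∀ (G : Type u) [AddCommGroup G] [Module A G] [Module.Finite A G]
      [Module.Projective A G] (x : G →ₗ[A] X), ∃ n, ∃ y : G →ₗ[A] F n, ∀ g, c n (y g) = x g := by
    intro G _ _ _ _ x
    obtain ⟨n, hn⟩ := x.range_le_of_finite_of_monotone _ hmono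
      fun x => Module.DirectLimit.exists_of x
    exact ⟨n, x.exists_lift_of_range_le (c n) hn⟩
  refine ⟨X, inferInstance, inferInstance, c 0, ?_, fun i f => ?_⟩
  · intro G _ _ _ _ x κ _ m g hmg
    obtain ⟨n, y, hy⟩ := hlift G x
    obtain ⟨N, _, _, i, y', h, hi, hiE, hij, hhy, hrel⟩ :=
      isCellular_cellTowerMap α hne hα hαE (ModuleCat.of A M) n G y κ m g (by
        intro k
        apply hci n
        exact (map_add (c n) _ _).trans ((congrArg₂ (· + ·) (hc 0 n n.zero_le (m k))
          (hy (g k))).trans ((hmg k).trans (map_zero (c n)).symm)))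
    exact ⟨N, inferInstance, inferInstance, i, y', c n ∘ₗ h, hi, hiE,
      fun m => (congrArg (c n) (hij m)).trans (hc 0 n n.zero_le m),
      fun g => (congrArg (c n) (hhy g)).trans (hy g), hrel⟩
  -- A map from `P i` lands in some stage `F n`, and the cell attached along it in stage `n + 1`
  -- extends it.
  · obtain ⟨n, y, hy⟩ := hlift (P i) f
    obtain ⟨g, hg⟩ := CellAttachment.exists_extension α (F n) i y
    let g' : Q i →ₗ[A] F (n + 1) := g
    have hg' : ∀ p, g' (α i p) = φ n (n + 1) n.le_succ (y p) := fun p =>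
      (hg p).trans (LinearMap.congr_fun (cellTowerMap_succ α _ n) _).symm
    exact ⟨c (n + 1) ∘ₗ g', fun p => by
      rw [LinearMap.comp_apply, hg', hc, hy]⟩

end Tower

/-! ### Local modules and the trace of the class. -/

section Local

variable {A : Type u} [Ring A] {ι : Type u} {P Q : ι → Type u}
  [∀ i, AddCommGroup (P i)] [∀ i, Module A (P i)]
  [∀ i, AddCommGroup (Q i)] [∀ i, Module A (Q i)]

/-- A module `W` is local for a family of maps `α i : P i → Q i` if every map `P i → W` extends
uniquely along `α i`. -/
def IsLocalFor (α : ∀ i, P i →ₗ[A] Q i) (W : Type*) [AddCommGroup W] [Module A W] : Prop :=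
  ∀ i, Function.Bijective fun g : Q i →ₗ[A] W => g ∘ₗ α i

variable {E : CategoryTheory.ObjectProperty (ModuleCat.{u} A)} [E.IsClosedUnderExtensions]

/-- The submodule of `X` generated by the images of all maps from the modules in the stable closure
of `E`. -/
def traceSubmodule (E : CategoryTheory.ObjectProperty (ModuleCat.{u} A))
    [E.IsClosedUnderExtensions] (hne : E.Nonempty) (X : Type u) [AddCommGroup X] [Module A X] :
    Submodule A X where
  carrier := {x | ∃ (Z : Type u) (_ : AddCommGroup Z) (_ : Module A Z) (ψ : Z →ₗ[A] X),
    StablyMem E Z ∧ x ∈ LinearMap.range ψ}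
  zero_mem' := ⟨PUnit, inferInstance, inferInstance, 0, .of_subsingleton hne _, zero_mem _⟩
  add_mem' := by
    rintro _ _ ⟨Z, _, _, ψ, hZ, z, rfl⟩ ⟨Z', _, _, ψ', hZ', z', rfl⟩
    exact ⟨Z × Z', inferInstance, inferInstance, ψ.coprod ψ', hZ.prod hZ', (z, z'), rfl⟩
  smul_mem' := by
    rintro a _ ⟨Z, _, _, ψ, hZ, h⟩
    exact ⟨Z, inferInstance, inferInstance, ψ, hZ, Submodule.smul_mem _ a h⟩

theorem range_le_traceSubmodule (hne : E.Nonempty) {X Z : Type u} [AddCommGroup X] [Module A X]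
    [AddCommGroup Z] [Module A Z] (hZ : StablyMem E Z) (ψ : Z →ₗ[A] X) :
    LinearMap.range ψ ≤ traceSubmodule E hne X :=
  fun _ hx => ⟨Z, inferInstance, inferInstance, ψ, hZ, hx⟩

/-- The stable closure has finite products, so one module covers finitely many generators. -/
theorem exists_le_range_of_le_traceSubmodule (hne : E.Nonempty) {X : Type u} [AddCommGroup X]
    [Module A X] (D : Submodule A X) (hD : D.FG) (h : D ≤ traceSubmodule E hne X) :
    ∃ (Z : Type u) (_ : AddCommGroup Z) (_ : Module A Z) (ψ : Z →ₗ[A] X),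
      StablyMem E Z ∧ D ≤ LinearMap.range ψ := by
  induction D, hD using Submodule.fg_induction with
  | singleton x =>
    obtain ⟨Z, _, _, ψ, hZ, hx⟩ := h (Submodule.mem_span_singleton_self x)
    exact ⟨Z, inferInstance, inferInstance, ψ, hZ, by
      rwa [Submodule.span_singleton_le_iff_mem]⟩
  | sup D D' _ _ ih ih' =>
    obtain ⟨Z, _, _, ψ, hZ, hD⟩ := ih (le_sup_left.trans h)
    obtain ⟨Z', _, _, ψ', hZ', hD'⟩ := ih' (le_sup_right.trans h)
    refine ⟨Z × Z', inferInstance, inferInstance, ψ.coprod ψ', hZ.prod hZ', ?_⟩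
    rw [LinearMap.range_coprod]
    exact sup_le_sup hD hD'

/-- Existence of extensions passes from `X` to the quotient because `P i` is projective; dividing by
the trace forces uniqueness. -/
theorem isLocalFor_quotient_traceSubmodule (hne : E.Nonempty) [∀ i, Module.Finite A (P i)]
    [∀ i, Module.Projective A (P i)] [∀ i, Module.Projective A (Q i)]
    (α : ∀ i, P i →ₗ[A] Q i) (hα : ∀ i, Function.Injective (α i))
    (hαE : ∀ i, StablyMem E (Q i ⧸ LinearMap.range (α i)))
    (X : Type u) [AddCommGroup X] [Module A X]
    (hX : ∀ i (f : P i →ₗ[A] X), ∃ g : Q i →ₗ[A] X, ∀ p, g (α i p) = f p) :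
    IsLocalFor α (X ⧸ traceSubmodule E hne X) := by
  intro i
  constructor
  · have key : ∀ v : Q i →ₗ[A] X ⧸ traceSubmodule E hne X, v ∘ₗ α i = 0 → v = 0 := by
      intro v hv
      obtain ⟨w, rfl⟩ := Module.projective_lifting_property
        (traceSubmodule E hne X).mkQ v (Submodule.mkQ_surjective _)
      have hr : LinearMap.range (w ∘ₗ α i) ≤ traceSubmodule E hne X := by
        rintro _ ⟨p, rfl⟩
        rw [← Submodule.Quotient.mk_eq_zero]
        exact LinearMap.congr_fun hv p
      have hfg : (LinearMap.range (w ∘ₗ α i)).FG := by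
        rw [LinearMap.range_eq_map]
        exact Module.Finite.fg_top.map _
      obtain ⟨Z, _, _, ψ, hZ, hle⟩ := exists_le_range_of_le_traceSubmodule hne _ hfg hr
      obtain ⟨β, hβ⟩ := (w ∘ₗ α i).exists_lift_of_range_le ψ hle
      obtain ⟨d, -, hd⟩ := ModulePushout.exists_desc ψ w hβ
      -- The lift `w` of `v` factors through this pushout, which is an extension of the cokernel of
      -- `α i` by `Z`. Hence `w` takes values in the trace and `v = 0`.
      have hY : StablyMem E (ModulePushout β (α i)) :=
        .of_exact _ (Submodule.mkQ _) (ModulePushout.inl_injective β (α i) (hα i))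
          (LinearMap.exact_map_mkQ_range _) (Submodule.mkQ_surjective _) hZ
          (.coker_inl hne β (α i) (hαE i))
      ext q
      rw [LinearMap.comp_apply, ← hd]
      exact (Submodule.Quotient.mk_eq_zero _).2 (range_le_traceSubmodule hne hY d ⟨_, rfl⟩)
    intro v v' h
    rw [← sub_eq_zero]
    apply key
    rw [LinearMap.sub_comp, sub_eq_zero]
    exact h
  · intro f
    obtain ⟨f', rfl⟩ := Module.projective_lifting_property
      (traceSubmodule E hne X).mkQ f (Submodule.mkQ_surjective _)
    obtain ⟨g, hg⟩ := hX i f'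
    refine ⟨(traceSubmodule E hne X).mkQ ∘ₗ g, ?_⟩
    ext p
    simp [hg]

/-- The local quotient of the cellular module detects `D`, and finite presentation of `Z` brings the
resulting map `Z → X` down to an extension of `M`. -/
theorem exists_extension_of_forall_isLocalFor (hne : E.Nonempty)
    (hfp : ∀ X, E X → Module.FinitePresentation A X) [∀ i, Module.Finite A (P i)]
    [∀ i, Module.Projective A (P i)] [∀ i, Module.Projective A (Q i)]
    (α : ∀ i, P i →ₗ[A] Q i) (hα : ∀ i, Function.Injective (α i))
    (hαE : ∀ i, StablyMem E (Q i ⧸ LinearMap.range (α i)))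
    (M : Type u) [AddCommGroup M] [Module A M] (D : Submodule A M) (hD : D.FG)
    (h : ∀ (W : Type u) [AddCommGroup W] [Module A W] (f : M →ₗ[A] W), IsLocalFor α W →
      ∀ m ∈ D, f m = 0) :
    ∃ (N Z : Type u) (_ : AddCommGroup N) (_ : Module A N) (_ : AddCommGroup Z) (_ : Module A Z)
      (i : M →ₗ[A] N) (φ : Z →ₗ[A] N), Function.Injective i ∧
      StablyMem E (N ⧸ LinearMap.range i) ∧ StablyMem E Z ∧ D.map i ≤ LinearMap.range φ := by
  obtain ⟨X, _, _, j, hj, hX⟩ := exists_isCellular α hne hα hαE M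
  have hDX : D.map j ≤ traceSubmodule E hne X := by
    rintro _ ⟨m, hm, rfl⟩
    rw [← Submodule.Quotient.mk_eq_zero]
    exact h _ ((traceSubmodule E hne X).mkQ ∘ₗ j)
      (isLocalFor_quotient_traceSubmodule hne α hα hαE X hX) m hm
  obtain ⟨Z, _, _, ψ, hZ, hle⟩ := exists_le_range_of_le_traceSubmodule hne _ (hD.map j) hDX
  have := hZ.finitePresentation hfp
  obtain ⟨n, π, hπ⟩ := Module.Finite.exists_fin' A Z
  obtain ⟨a, s, hs⟩ := Submodule.fg_iff_exists_fin_generating_family.1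
    (Module.FinitePresentation.fg_ker π hπ)
  obtain ⟨b, t, ht⟩ := Submodule.fg_iff_exists_fin_generating_family.1 hD
  have hu : ∀ k, ∃ g, ψ (π g) = j (t k) := by
    intro k
    obtain ⟨z, hz⟩ := hle ⟨t k, ht ▸ Submodule.subset_span ⟨k, rfl⟩, rfl⟩
    obtain ⟨g, rfl⟩ := hπ z
    exact ⟨g, hz⟩
  choose u hu using hu
  -- The equations indexed by `Fin a` are the relations of `Z`, so that `y` descends to `Z`; those
  -- indexed by `Fin b` say that the generators of `D` are hit.
  obtain ⟨N, _, _, i, y, -, hi, hiE, -, -, hrel⟩ := hj (Fin n → A) (ψ ∘ₗ π) (Fin a ⊕ Fin b)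
    (Sum.elim 0 t) (Sum.elim s (-u)) (by
      rintro (k | k)
      · have : s k ∈ LinearMap.ker π := hs ▸ Submodule.subset_span ⟨k, rfl⟩
        simp [LinearMap.mem_ker.1 this]
      · simp [hu])
  have hy : LinearMap.ker π ≤ LinearMap.ker y := by
    rw [← hs, Submodule.span_le]
    rintro _ ⟨k, rfl⟩
    simpa using hrel (Sum.inl k)
  obtain ⟨φ, hφ⟩ := π.exists_factor_of_ker_le hπ y fun x hx => hy hx
  refine ⟨N, Z, inferInstance, inferInstance, inferInstance, inferInstance, i, φ, hi, hiE, hZ, ?_⟩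
  rw [← ht, Submodule.map_span, Submodule.span_le]
  rintro _ ⟨_, ⟨k, rfl⟩, rfl⟩
  refine ⟨π (u k), ?_⟩
  have := hrel (Sum.inr k)
  simp only [Sum.elim_inr, Pi.neg_apply, map_neg, ← sub_eq_add_neg, sub_eq_zero] at this
  rw [hφ, this]

end Local

/-! ### Local modules and modules over the universal localisation. -/

section LocalModulesAndLocalisation

variable {R : Type*} [Ring R]

/-- The right `R`-linear map `R → W`, `r ↦ w r`. -/
def elementMap {W : Type*} [AddCommGroup W] [Module Rᵐᵒᵖ W] : W →+ (R →ₗ[Rᵐᵒᵖ] W) where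
  toFun w :=
    { toFun := fun r => MulOpposite.op r • w
      map_add' := fun r s => by rw [MulOpposite.op_add, add_smul]
      map_smul' := fun r s => by
        rw [MulOpposite.smul_eq_mul_unop, MulOpposite.op_mul, MulOpposite.op_unop, mul_smul]
        rfl }
  map_zero' := by ext; simp
  map_add' _ _ := by ext; simp

@[simp] theorem elementMap_apply {W : Type*} [AddCommGroup W] [Module Rᵐᵒᵖ W] (w : W) (r : R) :
    elementMap w r = MulOpposite.op r • w :=
  rfl

variable {ι : Type*} {P Q : ι → Type*}
    [∀ i, AddCommGroup (P i)] [∀ i, Module Rᵐᵒᵖ (P i)]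
    [∀ i, AddCommGroup (Q i)] [∀ i, Module Rᵐᵒᵖ (Q i)]
    (α : ∀ i, P i →ₗ[Rᵐᵒᵖ] Q i)

/-- The unique extension of maps along the maps of a family for which the target is local. -/
noncomputable def localExtension {W : Type*} [AddCommGroup W] [Module Rᵐᵒᵖ W]
    (hW : ∀ i, Function.Bijective fun g : Q i →ₗ[Rᵐᵒᵖ] W => g ∘ₗ α i) (i : ι) :
    (P i →ₗ[Rᵐᵒᵖ] W) ≃+ (Q i →ₗ[Rᵐᵒᵖ] W) :=
  (AddEquiv.ofBijective (AddMonoidHom.mk' (fun g : Q i →ₗ[Rᵐᵒᵖ] W => g ∘ₗ α i)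
    fun _ _ => LinearMap.add_comp _ _ _) (hW i)).symm

theorem localExtension_eq_iff {W : Type*} [AddCommGroup W] [Module Rᵐᵒᵖ W]
    (hW : ∀ i, Function.Bijective fun g : Q i →ₗ[Rᵐᵒᵖ] W => g ∘ₗ α i) (i : ι)
    (f : P i →ₗ[Rᵐᵒᵖ] W) (g : Q i →ₗ[Rᵐᵒᵖ] W) :
    localExtension α hW i f = g ↔ ∀ p, f p = g (α i p) := by
  unfold localExtension
  rw [AddEquiv.symm_apply_eq, LinearMap.ext_iff]
  rfl

theorem localExtension_apply {W : Type*} [AddCommGroup W] [Module Rᵐᵒᵖ W]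
    (hW : ∀ i, Function.Bijective fun g : Q i →ₗ[Rᵐᵒᵖ] W => g ∘ₗ α i) (i : ι)
    (f : P i →ₗ[Rᵐᵒᵖ] W) (p : P i) : localExtension α hW i f (α i p) = f p :=
  ((localExtension_eq_iff α hW i f _).1 rfl p).symm

/-- The right `R`-action on a local module extends to an action of the universal localisation. -/
theorem UniversalLocalisation.exists_action {W : Type*} [AddCommGroup W] [Module Rᵐᵒᵖ W]
    (hW : ∀ i, Function.Bijective fun g : Q i →ₗ[Rᵐᵒᵖ] W => g ∘ₗ α i) :
    ∃ θ : UniversalLocalisation α →+* (AddMonoid.End W)ᵐᵒᵖ,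
      ∀ r w, (θ (of α r)).unop w = MulOpposite.op r • w := by
  -- The symbol `ξ (α i)⁻¹ (q)` sends `w` to the value at `q` of the unique extension of `p ↦ w
  -- ξ(p)`. The opposite ring appears because the action is on the right.
  let G : R ⊕ (Σ i, (P i →ₗ[Rᵐᵒᵖ] R) × Q i) → (AddMonoid.End W)ᵐᵒᵖ :=
    Sum.elim
      (fun r => .op (AddMonoidHom.mk' (fun w => MulOpposite.op r • w) fun _ _ => smul_add _ _ _))
      (fun z => .op (AddMonoidHom.mk'
        (fun w => localExtension α hW z.1 (elementMap w ∘ₗ z.2.1) z.2.2)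
        fun v w => by rw [map_add, LinearMap.add_comp, map_add]; rfl))
  have hGl : ∀ r w, (FreeRing.lift G (FreeRing.of (Sum.inl r))).unop w =
      MulOpposite.op r • w := fun r w => by rw [FreeRing.lift_of]; rfl
  have hGr : ∀ i ξ q w, (FreeRing.lift G (FreeRing.of (Sum.inr ⟨i, ξ, q⟩))).unop w =
      localExtension α hW i (elementMap w ∘ₗ ξ) q := fun i ξ q w => by rw [FreeRing.lift_of]; rfl
  have hmul : ∀ (s t : (AddMonoid.End W)ᵐᵒᵖ) w, (s * t).unop w = t.unop (s.unop w) :=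
    fun _ _ _ => rfl
  have hadd : ∀ (s t : (AddMonoid.End W)ᵐᵒᵖ) w, (s + t).unop w = s.unop w + t.unop w :=
    fun _ _ _ => rfl
  have hsum : ∀ (n : ℕ) (s : Fin n → (AddMonoid.End W)ᵐᵒᵖ) w,
      (∑ k, s k).unop w = ∑ k, (s k).unop w := fun n s w =>
    map_sum (AddMonoidHom.mk' (fun s : (AddMonoid.End W)ᵐᵒᵖ => s.unop w) fun _ _ => rfl) _ _
  have hG : ∀ ⦃x y⦄, UniversalLocalisationRel α x y →
      FreeRing.lift G x = FreeRing.lift G y := by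
    intro x y h
    apply MulOpposite.unop_injective
    ext w
    induction h with
    | one => rw [hGl, map_one, MulOpposite.op_one, one_smul]; rfl
    | add r s => rw [map_add, hadd, hGl, hGl, hGl, MulOpposite.op_add, add_smul]
    | mul r s => rw [map_mul, hmul, hGl, hGl, hGl, MulOpposite.op_mul, mul_smul]
    | symbol_add i ξ q q' => rw [map_add, hadd, hGr, hGr, hGr, map_add]
    | symbol_smul i ξ q r => rw [map_mul, hmul, hGl, hGr, hGr, map_smul]
    | left_inv i ξ p => rw [hGl, hGr, localExtension_apply]; rfl
    | right_inv i n p π hp η q =>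
      rw [map_sum, hsum]
      simp only [map_mul, hmul, hGl, hGr]
      -- By the dual basis, the sum of the extended maps is the extension of `x ↦ w η(α i x)`, which
      -- is `q ↦ w η(q)` by uniqueness.
      rw [← LinearMap.sum_apply, ← map_sum,
        (localExtension_eq_iff α hW i _ (elementMap w ∘ₗ η)).2]
      · rfl
      · intro x
        conv_rhs => rw [hp x]
        simp
  refine ⟨RingQuot.lift ⟨FreeRing.lift G, hG⟩, fun r w => ?_⟩
  rw [← hGl r w]
  change (RingQuot.lift ⟨FreeRing.lift G, hG⟩ (RingQuot.mkRingHom _ _)).unop w = _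
  rw [RingQuot.lift_mkRingHom_apply]

/-- A map to a local module factors through the induced module of the universal localisation. -/
theorem UniversalLocalisation.exists_factor_induced {M W : Type*} [AddCommGroup M] [Module Rᵐᵒᵖ M]
    [AddCommGroup W] [Module Rᵐᵒᵖ W]
    (hW : ∀ i, Function.Bijective fun g : Q i →ₗ[Rᵐᵒᵖ] W => g ∘ₗ α i) (f : M →ₗ[Rᵐᵒᵖ] W) :
    ∃ F : Induced (of α) M →+ W, ∀ m, F (Induced.of (of α) M m) = f m := by
  obtain ⟨θ, hθ⟩ := exists_action α hW
  -- The factorisation sends `m ⊗ s` to `f(m) s`.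
  refine ⟨Induced.lift (of α)
    (AddMonoidHom.mk' (fun m => AddMonoidHom.mk' (fun s => (θ s).unop (f m))
      (fun s t => by rw [map_add]; rfl)) (fun m m' => by ext s; simp))
    (fun m r s => ?_), fun m => ?_⟩
  · change (θ s).unop (f (MulOpposite.op r • m)) = (θ (of α r * s)).unop (f m)
    rw [map_mul, map_smul, ← hθ]
    rfl
  · change (θ 1).unop (f m) = f m
    rw [map_one]
    rfl

namespace Induced

variable {S : Type*} [Ring S] (φ : R →+* S) {M : Type*} [AddCommGroup M] [Module Rᵐᵒᵖ M]

open UniversalLocalisation (rmul rmul_tmul)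

theorem rmul_one (x : Induced φ M) : rmul φ M 1 x = x := by
  induction x using Induced.induction_on with
  | h0 => simp
  | ha x y hx hy => simp [hx, hy]
  | ht m s => simp

theorem rmul_zero (x : Induced φ M) : rmul φ M 0 x = 0 := by
  induction x using Induced.induction_on with
  | h0 => simp
  | ha x y hx hy => simp [hx, hy]
  | ht m s =>
    rw [rmul_tmul, mul_zero, ← add_eq_left (a := tmul φ m 0), ← tmul_add, add_zero]

theorem rmul_add (s t : S) (x : Induced φ M) :
    rmul φ M (s + t) x = rmul φ M s x + rmul φ M t x := by
  induction x using Induced.induction_on with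
  | h0 => simp
  | ha x y hx hy => rw [map_add, map_add, map_add, hx, hy]; abel
  | ht m u => simp [mul_add, tmul_add]

theorem rmul_mul (s t : S) (x : Induced φ M) :
    rmul φ M (s * t) x = rmul φ M t (rmul φ M s x) := by
  induction x using Induced.induction_on with
  | h0 => simp
  | ha x y hx hy => simp [hx, hy]
  | ht m u => simp [mul_assoc]

/-- Right multiplication as an additive map in the scalar. -/
def rmulHom (x : Induced φ M) : S →+ Induced φ M :=
  AddMonoidHom.mk' (fun s => rmul φ M s x) fun s t => rmul_add φ s t x

/-- The right `R`-module structure on `M ⊗_R S`. -/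
instance instModule : Module Rᵐᵒᵖ (Induced φ M) where
  smul r x := rmul φ M (φ r.unop) x
  one_smul x := by
    change rmul φ M (φ 1) x = x
    rw [map_one, rmul_one]
  mul_smul r s x := by
    change rmul φ M (φ (s.unop * r.unop)) x = rmul φ M (φ r.unop) (rmul φ M (φ s.unop) x)
    rw [map_mul, rmul_mul]
  smul_zero r := map_zero _
  smul_add r x y := map_add _ x y
  add_smul r s x := by
    change rmul φ M (φ (r.unop + s.unop)) x = _
    rw [map_add, rmul_add]
    rfl
  zero_smul x := by
    change rmul φ M (φ 0) x = 0
    rw [map_zero, rmul_zero]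

/-- The natural map `M → M ⊗_R S` as a map of right `R`-modules. -/
def ofLinear (M : Type*) [AddCommGroup M] [Module Rᵐᵒᵖ M] : M →ₗ[Rᵐᵒᵖ] Induced φ M :=
  { of φ M with
    map_smul' := fun r m => by
      change tmul φ (MulOpposite.op r.unop • m) 1 = rmul φ M (φ r.unop) (tmul φ m 1)
      rw [smul_tmul, rmul_tmul, one_mul, mul_one] }

theorem ofLinear_apply (m : M) : ofLinear φ M m = of φ M m :=
  rfl

theorem tmul_eq_rmul_of (m : M) (s : S) : tmul φ m s = rmul φ M s (of φ M m) := by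
  change _ = rmul φ M s (tmul φ m 1)
  rw [rmul_tmul, one_mul]

theorem subsingleton_iff : Subsingleton (Induced φ M) ↔ ∀ m, of φ M m = 0 := by
  refine ⟨fun h m => Subsingleton.elim _ _, fun h => ⟨fun x y => ?_⟩⟩
  have h0 : ∀ x : Induced φ M, x = 0 := by
    intro x
    induction x using Induced.induction_on with
    | h0 => rfl
    | ha x y hx hy => rw [hx, hy, add_zero]
    | ht m s => rw [tmul_eq_rmul_of, h, map_zero]
  rw [h0 x, h0 y]

end Induced

/-- The induced modules of the universal localisation are local. -/
theorem UniversalLocalisation.induced_isLocal [∀ i, Module.Finite Rᵐᵒᵖ (P i)]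
    [∀ i, Module.Projective Rᵐᵒᵖ (P i)] [∀ i, Module.Finite Rᵐᵒᵖ (Q i)]
    [∀ i, Module.Projective Rᵐᵒᵖ (Q i)] (M : Type*) [AddCommGroup M] [Module Rᵐᵒᵖ M] (i : ι) :
    Function.Bijective fun g : Q i →ₗ[Rᵐᵒᵖ] Induced (of α) M => g ∘ₗ α i := by
  obtain ⟨n, p, π, hp⟩ := exists_dual_basis (R := R) (P i)
  obtain ⟨l, y, η, hy⟩ := exists_dual_basis (R := R) (Q i)
  constructor
  -- Expanding `q` in the dual basis of `Q i` and applying `sum_symbol` gives `v(q) = ∑ v(α i (p k))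
  -- · symbol (π k) q`, which vanishes.
  · have key : ∀ v : Q i →ₗ[Rᵐᵒᵖ] Induced (of α) M, v ∘ₗ α i = 0 → v = 0 := by
      intro v hv
      ext q
      have h1 : ∀ k, ∑ j, rmul (of α) M (of α (η j (α i (p k)))) (v (y j)) = 0 := by
        intro k
        rw [← show v (α i (p k)) = 0 from LinearMap.congr_fun hv (p k)]
        conv_rhs => rw [hy (α i (p k)), map_sum]
        simp only [map_smul]
        rfl
      have h2 : v q = ∑ j, Induced.rmulHom (of α) (v (y j)) (of α (η j q)) := by
        conv_lhs => rw [hy q, map_sum]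
        simp only [map_smul]
        rfl
      have h3 : ∀ j, Induced.rmulHom (of α) (v (y j)) (of α (η j q)) =
          ∑ k, rmul (of α) M (symbol α (π k) q)
            (rmul (of α) M (of α (η j (α i (p k)))) (v (y j))) := by
        intro j
        rw [← sum_symbol α p π hp (η j) q, map_sum]
        exact Finset.sum_congr rfl fun k _ => Induced.rmul_mul _ _ _ _
      rw [h2, LinearMap.zero_apply]
      simp only [h3]
      rw [Finset.sum_comm]
      refine Finset.sum_eq_zero fun k _ => ?_
      rw [← map_sum, h1, map_zero]
    intro v v' h
    rw [← sub_eq_zero]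
    apply key
    rw [LinearMap.sub_comp, sub_eq_zero]
    exact h
  · intro f
    -- Formally this is `f ∘ (α i)⁻¹`, with `(α i)⁻¹ (q)` expanded in the dual basis of `P i`.
    refine ⟨{ toFun := fun q => ∑ k, rmul (of α) M (symbol α (π k) q) (f (p k))
              map_add' := fun q q' => ?_
              map_smul' := fun r q => ?_ }, ?_⟩
    · simp only [symbol_add, Induced.rmul_add, Finset.sum_add_distrib]
    · rw [RingHom.id_apply, Finset.smul_sum]
      refine Finset.sum_congr rfl fun k _ => ?_
      rw [← MulOpposite.op_unop r, symbol_smul, Induced.rmul_mul]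
      rfl
    · ext x
      change ∑ k, rmul (of α) M (symbol α (π k) (α i x)) (f (p k)) = f x
      conv_rhs => rw [hp x, map_sum]
      refine Finset.sum_congr rfl fun k _ => ?_
      rw [symbol_map, map_smul]
      rfl

end LocalModulesAndLocalisation

/-! ### Projective presentations of the objects of the class. -/

section Presentations

variable {R : Type u} [Ring R] {E : CategoryTheory.ObjectProperty (ModuleCat.{u} Rᵐᵒᵖ)}

theorem projective_pi_right (n : ℕ) : Module.Projective Rᵐᵒᵖ (Fin n → R) := by
  let e : R ≃ₗ[Rᵐᵒᵖ] Rᵐᵒᵖ :=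
    { MulOpposite.opEquiv with
      map_add' := fun _ _ => rfl
      map_smul' := fun _ _ => rfl }
  exact .of_equiv (LinearEquiv.piCongrRight fun _ : Fin n => e).symm

theorem projective_ker_of_hasProjectiveDimensionLE_one {A : Type u} [Ring A] {F X : Type u}
    [AddCommGroup F] [Module A F] [Module.Projective A F] [AddCommGroup X] [Module A X]
    (hX : CategoryTheory.HasProjectiveDimensionLE (ModuleCat.of A X) 1)
    (f : F →ₗ[A] X) (hf : Function.Surjective f) : Module.Projective A (LinearMap.ker f) := by
  have hS : (CategoryTheory.ShortComplex.mk (ModuleCat.ofHom (LinearMap.ker f).subtype)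
      (ModuleCat.ofHom f) (by ext x; exact x.2)).ShortExact :=
    { exact := (CategoryTheory.ShortComplex.ShortExact.moduleCat_exact_iff_function_exact _).2
        (LinearMap.exact_subtype_ker_map f)
      mono_f := (ModuleCat.mono_iff_injective _).2 (Submodule.subtype_injective _)
      epi_g := (ModuleCat.epi_iff_surjective _).2 hf }
  have hF : CategoryTheory.Projective (ModuleCat.of A F) :=
    (IsProjective.iff_projective F).1 inferInstance
  -- The bounds are strict: `hX` says dimension less than `2`, and dimension less than `1` means
  -- projective.
  have h : CategoryTheory.HasProjectiveDimensionLT (ModuleCat.of A (LinearMap.ker f)) 1 :=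
    hS.hasProjectiveDimensionLT_X₁ 1 (inferInstanceAs
      (CategoryTheory.HasProjectiveDimensionLT (ModuleCat.of A F) 1)) hX
  exact (IsProjective.iff_projective _).2
    (CategoryTheory.projective_iff_hasProjectiveDimensionLT_one.2 h)

/-- The kernel of a surjection `R ^ n → X` is finitely generated by finite presentation and
projective by the dimension bound, so its inclusion is one of the inverted maps. -/
theorem PresentationIndex.exists_presentation {X : ModuleCat.{u} Rᵐᵒᵖ} (hX : E X)
    (hfp : Module.FinitePresentation Rᵐᵒᵖ X)
    (hpd : CategoryTheory.HasProjectiveDimensionLE X 1) :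
    ∃ (a : PresentationIndex E) (c : ((Fin a.n → R) ⧸ a.L) →ₗ[Rᵐᵒᵖ] X),
      Function.Surjective c ∧ ∀ q, c q = 0 ↔ ∃ p, a.α p = q := by
  obtain ⟨n, K, ⟨e⟩⟩ := UniversalLocalisationAt.exists_equiv_quotient (R := R) X
  have hFn : Module.Projective Rᵐᵒᵖ (Fin n → R) := projective_pi_right n
  have hbot : Module.Finite Rᵐᵒᵖ ((Fin n → R) ⧸ (⊥ : Submodule Rᵐᵒᵖ (Fin n → R))) :=
    UniversalLocalisationAt.finite_quotient _
  let b := Submodule.quotEquivOfEqBot (⊥ : Submodule Rᵐᵒᵖ (Fin n → R)) rfl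
  have hFin : Module.Finite Rᵐᵒᵖ (Fin n → R) := .equiv b
  let f : (Fin n → R) →ₗ[Rᵐᵒᵖ] X := e.toLinearMap ∘ₗ K.mkQ
  have hf : Function.Surjective f := e.surjective.comp K.mkQ_surjective
  have hkp : Module.Projective Rᵐᵒᵖ (LinearMap.ker f) :=
    projective_ker_of_hasProjectiveDimensionLE_one hpd f hf
  have hkf : Module.Finite Rᵐᵒᵖ (LinearMap.ker f) :=
    .of_fg (Module.FinitePresentation.fg_ker f hf)
  obtain ⟨m, K', ⟨e'⟩⟩ := UniversalLocalisationAt.exists_equiv_quotient (R := R) (LinearMap.ker f)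
  let α : ((Fin m → R) ⧸ K') →ₗ[Rᵐᵒᵖ] ((Fin n → R) ⧸ (⊥ : Submodule Rᵐᵒᵖ (Fin n → R))) :=
    b.symm.toLinearMap ∘ₗ (LinearMap.ker f).subtype ∘ₗ e'.toLinearMap
  let c : ((Fin n → R) ⧸ (⊥ : Submodule Rᵐᵒᵖ (Fin n → R))) →ₗ[Rᵐᵒᵖ] X := f ∘ₗ b.toLinearMap
  have hc : Function.Surjective c := hf.comp b.surjective
  have hcα : ∀ q, c q = 0 ↔ ∃ p, α p = q := by
    intro q
    constructor
    · intro h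
      exact ⟨e'.symm ⟨b q, h⟩, by simp [α]⟩
    · rintro ⟨p, rfl⟩
      simp [c, α]
  have hker : LinearMap.range α = LinearMap.ker c := by
    ext q
    exact (hcα q).symm
  exact ⟨{ m := m, n := n, K := K', L := ⊥
           projective_dom := .of_equiv e'.symm
           projective_cod := .of_equiv b.symm
           α := α
           injective := b.symm.injective.comp ((Submodule.subtype_injective _).comp e'.injective)
           coker_mem := ⟨X, hX, ⟨(Submodule.quotEquivOfEq _ _ hker).trans
            (c.quotKerEquivOfSurjective hc)⟩⟩ }, c, hc, hcα⟩

end Presentations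

/-! ### Vanishing of `Hom` and `Ext¹` into local modules. -/

section Orthogonality

variable {A : Type*} [Ring A] {P Q X W : Type*} [AddCommGroup P] [Module A P]
  [AddCommGroup Q] [Module A Q] [AddCommGroup X] [Module A X] [AddCommGroup W] [Module A W]
  {α : P →ₗ[A] Q} {c : Q →ₗ[A] X}

theorem eq_zero_of_precomp_bijective (hc : Function.Surjective c)
    (hcα : ∀ q, c q = 0 ↔ ∃ p, α p = q)
    (hW : Function.Bijective fun g : Q →ₗ[A] W => g ∘ₗ α) (f : X →ₗ[A] W) : f = 0 := by
  have h : f ∘ₗ c = 0 := by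
    apply hW.injective
    ext p
    simp [(hcα (α p)).2 ⟨p, rfl⟩]
  ext x
  obtain ⟨q, rfl⟩ := hc x
  exact LinearMap.congr_fun h q

/-- This is `Ext¹(X, W) = 0`: lifting `c` to `l : Q → N` exhibits `N` as the pushout of `M` and `Q`
along `P`, and `f` extends over `Q` by locality of `W`. -/
theorem exists_extend_of_precomp_bijective [Module.Projective A Q]
    (hcα : ∀ q, c q = 0 ↔ ∃ p, α p = q)
    (hW : Function.Bijective fun g : Q →ₗ[A] W => g ∘ₗ α) {M N : Type*} [AddCommGroup M]
    [Module A M] [AddCommGroup N] [Module A N] (i : M →ₗ[A] N) (p : N →ₗ[A] X)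
    (hc : Function.Surjective c) (hi : Function.Injective i) (hip : Function.Exact i p)
    (hp : Function.Surjective p) (f : M →ₗ[A] W) : ∃ g : N →ₗ[A] W, ∀ m, g (i m) = f m := by
  obtain ⟨l, hl⟩ := Module.projective_lifting_property p c hp
  have hl' : ∀ q, p (l q) = c q := LinearMap.congr_fun hl
  have hM : ∀ x, ∃ m, i m = l (α x) := fun x =>
    (hip _).1 ((hl' _).trans ((hcα _).2 ⟨x, rfl⟩))
  let e := LinearEquiv.ofInjective i hi
  let γ : P →ₗ[A] M := e.symm.toLinearMap ∘ₗ (l ∘ₗ α).codRestrict (LinearMap.range i) hM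
  have hγ : ∀ x, i (γ x) = l (α x) := fun x =>
    congrArg Subtype.val (e.apply_symm_apply ⟨l (α x), hM x⟩)
  obtain ⟨k, hk⟩ := hW.surjective (f ∘ₗ γ)
  have hk' : ∀ x, k (α x) = f (γ x) := LinearMap.congr_fun hk
  have hs : Function.Surjective (i.coprod l) := by
    intro n
    obtain ⟨q, hq⟩ := hc (p n)
    obtain ⟨m, hm⟩ := (hip (n - l q)).1 (by rw [map_sub, hl', hq, sub_self])
    exact ⟨(m, q), by simp [hm]⟩
  obtain ⟨g, hg⟩ := (i.coprod l).exists_factor_of_ker_le hs (f.coprod k) (by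
    rintro ⟨m, q⟩ h
    rw [LinearMap.coprod_apply] at h ⊢
    dsimp only at h ⊢
    have h1 : c q = 0 := by
      have := congrArg p h
      rwa [map_add, hip.apply_apply_eq_zero, zero_add, hl', map_zero] at this
    obtain ⟨x, rfl⟩ := (hcα q).1 h1
    rw [← hγ, ← map_add] at h
    rw [hk', ← map_add, hi (h.trans (map_zero i).symm), map_zero])
  exact ⟨g, fun m => by simpa using hg (m, 0)⟩

end Orthogonality

/-! ### The two directions of the criterion. -/

section Kernel

variable {R : Type u} [Ring R] (E : CategoryTheory.ObjectProperty (ModuleCat.{u} Rᵐᵒᵖ))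

/-- As `M ⊗ R_E` is local, the natural map extends over `N`, and its composite with `φ` vanishes. -/
theorem Induced.of_eq_zero_of_extension
    (hfp : ∀ X, E X → Module.FinitePresentation Rᵐᵒᵖ X)
    (hpd : ∀ X, E X → CategoryTheory.HasProjectiveDimensionLE X 1)
    {M N : Type u} [AddCommGroup M] [Module Rᵐᵒᵖ M] [AddCommGroup N] [Module Rᵐᵒᵖ N]
    {E₁ E₂ : ModuleCat.{u} Rᵐᵒᵖ} (hE₁ : E E₁) (hE₂ : E E₂) (i : M →ₗ[Rᵐᵒᵖ] N)
    (p : N →ₗ[Rᵐᵒᵖ] E₁) (φ : E₂ →ₗ[Rᵐᵒᵖ] N) (hi : Function.Injective i)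
    (hip : Function.Exact i p) (hp : Function.Surjective p) (m : M)
    (hm : i m ∈ LinearMap.range φ) : Induced.of (UniversalLocalisationAt.of E) M m = 0 := by
  have hP : ∀ a : PresentationIndex E, Module.Finite Rᵐᵒᵖ ((Fin a.m → R) ⧸ a.K) :=
    fun a => UniversalLocalisationAt.finite_quotient _
  have hQ : ∀ a : PresentationIndex E, Module.Finite Rᵐᵒᵖ ((Fin a.n → R) ⧸ a.L) :=
    fun a => UniversalLocalisationAt.finite_quotient _
  have hP' := fun a : PresentationIndex E => a.projective_dom
  have hQ' := fun a : PresentationIndex E => a.projective_cod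
  have hloc := UniversalLocalisation.induced_isLocal (fun a : PresentationIndex E => a.α) M
  obtain ⟨a, c, hc, hca⟩ := PresentationIndex.exists_presentation hE₁ (hfp _ hE₁) (hpd _ hE₁)
  obtain ⟨b, d, hd, hdb⟩ := PresentationIndex.exists_presentation hE₂ (hfp _ hE₂) (hpd _ hE₂)
  obtain ⟨g, hg⟩ := exists_extend_of_precomp_bijective hca (hloc a) i p hc hi hip hp
    (Induced.ofLinear (UniversalLocalisationAt.of E) M)
  obtain ⟨e, he⟩ := hm
  have h0 : g ∘ₗ φ = 0 := eq_zero_of_precomp_bijective hd hdb (hloc b) _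
  rw [← Induced.ofLinear_apply, ← hg, ← he]
  exact LinearMap.congr_fun h0 e

theorem Induced.exists_extension_of_of_eq_zero
    (hfp : ∀ X, E X → Module.FinitePresentation Rᵐᵒᵖ X) [hext : E.IsClosedUnderExtensions]
    (hne : E.Nonempty) {M : Type u} [AddCommGroup M] [Module Rᵐᵒᵖ M] (D : Submodule Rᵐᵒᵖ M)
    (hD : D.FG) (h : ∀ m ∈ D, Induced.of (UniversalLocalisationAt.of E) M m = 0) :
    ∃ (N E₁ E₂ : ModuleCat.{u} Rᵐᵒᵖ) (i : M →ₗ[Rᵐᵒᵖ] N) (p : N →ₗ[Rᵐᵒᵖ] E₁)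
      (φ : E₂ →ₗ[Rᵐᵒᵖ] N), E E₁ ∧ E E₂ ∧ Function.Injective i ∧ Function.Exact i p ∧
      Function.Surjective p ∧ D.map i ≤ LinearMap.range φ := by
  have hP : ∀ a : PresentationIndex E, Module.Finite Rᵐᵒᵖ ((Fin a.m → R) ⧸ a.K) :=
    fun a => UniversalLocalisationAt.finite_quotient _
  have hP' := fun a : PresentationIndex E => a.projective_dom
  have hQ' := fun a : PresentationIndex E => a.projective_cod
  obtain ⟨N, Z, _, _, _, _, i, φ, hi, ⟨X, hX, hNX⟩, ⟨Y, hY, hZY⟩, hle⟩ :=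
    exists_extension_of_forall_isLocalFor hne hfp (fun a : PresentationIndex E => a.α)
      (fun a => a.injective) (fun a => by
        obtain ⟨X, hX, ⟨e⟩⟩ := a.coker_mem
        exact (StablyMem.of_mem hX).of_equiv hne e.symm) M D hD (by
      intro W _ _ f hW m hm
      obtain ⟨F, hF⟩ := UniversalLocalisation.exists_factor_induced _ hW f
      rw [← hF]
      exact (congrArg F (h m hm)).trans (map_zero F))
  -- The cokernel and `Z` lie only in the stable closure; adding `X` to `N` and `Y` to `Z` puts them
  -- into `E` itself.
  refine ⟨ModuleCat.of _ (N × X), ModuleCat.of _ ((N ⧸ LinearMap.range i) × X),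
    ModuleCat.of _ (Z × Y), LinearMap.inl _ N X ∘ₗ i, (Submodule.mkQ _).prodMap .id,
    LinearMap.inl _ N X ∘ₗ φ ∘ₗ LinearMap.fst _ Z Y, hNX, hZY,
    LinearMap.inl_injective.comp hi, ?_, ?_, ?_⟩
  · rintro ⟨n, x⟩
    rw [LinearMap.prodMap_apply, Prod.mk_eq_zero, Submodule.mkQ_apply,
      Submodule.Quotient.mk_eq_zero]
    constructor
    · rintro ⟨⟨m, rfl⟩, rfl⟩
      exact ⟨m, rfl⟩
    · rintro ⟨m, hm⟩
      exact ⟨⟨m, congrArg Prod.fst hm⟩, (congrArg Prod.snd hm).symm⟩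
  · exact (Submodule.mkQ_surjective _).prodMap Function.surjective_id
  · rintro _ ⟨m, hm, rfl⟩
    obtain ⟨z, hz⟩ := hle ⟨m, hm, rfl⟩
    exact ⟨(z, 0), congrArg (LinearMap.inl Rᵐᵒᵖ N X) hz⟩

end Kernel

theorem mainTheorem4 {R : Type u} [Ring R]
    (E : CategoryTheory.ObjectProperty (ModuleCat.{u} Rᵐᵒᵖ))
    (hfp : ∀ X, E X → Module.FinitePresentation Rᵐᵒᵖ X)
    (hpd : ∀ X, E X → CategoryTheory.HasProjectiveDimensionLE X 1)
    (hext : E.IsClosedUnderExtensions)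
    (hne : E.Nonempty)
    (M : Type u) [AddCommGroup M] [Module Rᵐᵒᵖ M] [Module.FinitePresentation Rᵐᵒᵖ M] :
    (∀ m : M, Induced.of (UniversalLocalisationAt.of E) M m = 0 ↔
      ∃ (N E₁ E₂ : ModuleCat.{u} Rᵐᵒᵖ) (i : M →ₗ[Rᵐᵒᵖ] N) (p : N →ₗ[Rᵐᵒᵖ] E₁)
        (φ : E₂ →ₗ[Rᵐᵒᵖ] N), E E₁ ∧ E E₂ ∧
        Function.Injective i ∧ Function.Exact i p ∧ Function.Surjective p ∧
        i m ∈ LinearMap.range φ) ∧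
    (Subsingleton (Induced (UniversalLocalisationAt.of E) M) ↔
      ∃ (N E₁ E₂ : ModuleCat.{u} Rᵐᵒᵖ) (i : M →ₗ[Rᵐᵒᵖ] N) (p : N →ₗ[Rᵐᵒᵖ] E₁)
        (φ : E₂ →ₗ[Rᵐᵒᵖ] N), E E₁ ∧ E E₂ ∧
        Function.Injective i ∧ Function.Exact i p ∧ Function.Surjective p ∧
        LinearMap.range i ≤ LinearMap.range φ) := by
  refine ⟨fun m => ⟨fun h => ?_, ?_⟩, fun h => ?_, ?_⟩
  -- The kernel of the natural map is a submodule, so it contains the span of `m`.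
  · obtain ⟨N, E₁, E₂, i, p, φ, hE₁, hE₂, hi, hip, hp, hle⟩ :=
      Induced.exists_extension_of_of_eq_zero E hfp hne
        (Submodule.span Rᵐᵒᵖ {m}) (Submodule.fg_span_singleton m) fun x hx =>
          (Submodule.span_singleton_le_iff_mem m
            (LinearMap.ker (Induced.ofLinear (UniversalLocalisationAt.of E) M))).2 h hx
    exact ⟨N, E₁, E₂, i, p, φ, hE₁, hE₂, hi, hip, hp,
      hle ⟨m, Submodule.mem_span_singleton_self m, rfl⟩⟩
  · rintro ⟨N, E₁, E₂, i, p, φ, hE₁, hE₂, hi, hip, hp, hm⟩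
    exact Induced.of_eq_zero_of_extension E hfp hpd hE₁ hE₂ i p φ hi hip hp m hm
  · obtain ⟨N, E₁, E₂, i, p, φ, hE₁, hE₂, hi, hip, hp, hle⟩ :=
      Induced.exists_extension_of_of_eq_zero E hfp hne (⊤ : Submodule Rᵐᵒᵖ M)
        Module.Finite.fg_top fun m _ => (Induced.subsingleton_iff _).1 h m
    exact ⟨N, E₁, E₂, i, p, φ, hE₁, hE₂, hi, hip, hp, by rwa [LinearMap.range_eq_map]⟩
  · rintro ⟨N, E₁, E₂, i, p, φ, hE₁, hE₂, hi, hip, hp, hle⟩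
    exact (Induced.subsingleton_iff _).2 fun m =>
      Induced.of_eq_zero_of_extension E hfp hpd hE₁ hE₂ i p φ hi hip hp m (hle ⟨m, rfl⟩)
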